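/- **Setting.** Let $\mathcal H$ be a separable infinite-dimensional real Hilbert space, let $a\otimes b$ denote the operator $\zeta\mapsto\langle a,\zeta\rangle b$, and let $x_t,y_t,z_t,u_t,v_t$ ($t\ge1$) be mean-zero $\mathcal H$-valued random variables on a probability space such that, for bounded linear operators $\mathcal A,\mathcal B$ on $\mathcal H$, $$y_t=\mathcal Ax_t+u_t,\qquad x_t=\mathcal Bz_t+v_t,\qquad \mathbb E[z_t\otimes v_t]=0 .$$ For processes $a,b$ write $\mathcal C_{ab}=\mathbb E[a_t\otimes b_t]$ and $\widehat{\mathcal C}_{ab}=T^{-1}\sum_{t=1}^Ta_t\otimes b_t$; $\|\cdot\|_{op}$ and $\|\cdot\|_{HS}$ are the operator and Hilbert–Schmidt norms. **Standing assumptions.** (i) $(x_t,z_t)_{t\ge1}$ is strictly stationary and geometrically strongly mixing, with $\mathbb E\|x_t\|^2<\infty$ and $\mathbb E\|z_t\|^2<\infty$. (ii) With $\mathfrak F_t=\sigma(\{z_s\}_{s\le t+1},\{u_s\}_{s\le t})$: $\mathbb E[u_t\mid\mathfrak F_{t-1}]=0$, $\mathbb E[u_t\otimes u_t\mid\mathfrak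 F_{t-1}]=\mathcal C_{uu}$, and $\sup_t\mathbb E[\|u_t\|^{2+\delta}\mid\mathfrak F_{t-1}]<\infty$ a.s. for some $\delta>0$. (iii) $\mathcal C_{zz}=\sum_j\mu_jg_j\otimes g_j$ with $(g_j)$ orthonormal and $\mu_1>\mu_2>\dots>0$; the operator $\mathcal Q=\mathcal C_{xz}^*\mathcal C_{zz}^{-1}\mathcal C_{xz}=\sum_j\mu_j^{-1}(\mathcal C_{xz}^*g_j)\otimes(\mathcal C_{xz}^*g_j)$ satisfies $\ker\mathcal Q=\{0\}$ and $\mathcal Q=\sum_j\nu_jh_j\otimes h_j$ with $(h_j)$ orthonormal and $\nu_1>\nu_2>\dots>0$; and $\|\mathcal A\|_{HS}<\infty$. (iv) $\|\widehat{\mathcal C}_{xz}-\mathcal C_{xz}\|_{HS}$, $\|\widehat{\mathcal C}_{zz}-\mathcal C_{zz}\|_{HS}$, $\|\widehat{\mathcal C}_{uz}-\mathcal C_{uz}\|_{HS}$ and $\|\widehat{\mathcal C}_{vz}\|_{HS}$ are $O_p(T^{-1/2})$, and $\|\widehat{\mathcal C}_{uu}-\mathcal C_{uu}\|_{HS}=o_p(1)$.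 **Additional assumptions.** (v) There are constants $m_x,m_z,m_u$ such that a.s. $\sup_t\|x_t\|\le m_x$, $\sup_t\|z_t\|\le m_z$ and $\sup_t\|u_t\|\le m_u$. (vi) The ordered eigenvalues $M_j$ of the covariance operator of $z_t\otimes z_t-\mathcal C_{zz}$, a random element of the Hilbert space of Hilbert–Schmidt operators, satisfy $M_j\le ab^j$ for some $a>0$ and $0<b<1$. (vii) Either $\mathbb E[v_t\mid\mathcal G_{t-1}]=0$ for all $t$, where $\mathcal G_t=\sigma(\{z_s\}_{s\le t+1},\{v_s\}_{s\le t})$, or $\|\widehat{\mathcal C}_{vz}\|_{op}=O(T^{-1/2}\log T)$ a.s. **Estimator.** Let $\alpha_1=\alpha_1(T)>0$ and $\alpha_2=\alpha_2(T)>0$ tend to $0$ as $T\to\infty$. Let $\widehat{\mathcal C}_{zz}=\sum_j\hat\mu_j\hat g_j\otimes\hat g_j$ be a spectral decomposition with $\hat\mu_1\ge\hat\mu_2\ge\dots\ge0$ and $(\hat g_j)$ orthonormal, let $K_1=\#\{j:\hat\mu_j^2>\alpha_1\}$ and $(\widehat{\mathcal C}_{zz})^{-1}_{K_1}=\sum_{j\le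 K_1}\hat\mu_j^{-1}\hat g_j\otimes\hat g_j$, and put $$\widehat{\mathcal P}=\widehat{\mathcal C}_{yz}^*(\widehat{\mathcal C}_{zz})^{-1}_{K_1}\widehat{\mathcal C}_{xz},\qquad \widehat{\mathcal Q}=\widehat{\mathcal C}_{xz}^*(\widehat{\mathcal C}_{zz})^{-1}_{K_1}\widehat{\mathcal C}_{xz}.$$ Let $\widehat{\mathcal Q}=\sum_j\hat\nu_j\hat h_j\otimes\hat h_j$ be a spectral decomposition with $\hat\nu_1\ge\hat\nu_2\ge\dots\ge0$ and $(\hat h_j)$ orthonormal, let $K_2=\#\{j:\hat\nu_j^2>\alpha_2\}$ and $\widehat{\mathcal Q}^{-1}_{K_2}=\sum_{j\le K_2}\hat\nu_j^{-1}\hat h_j\otimes\hat h_j$. The functional two-stage least squares estimator (F2SLSE) is $\widetilde{\mathcal A}=\widehat{\mathcal P}\,\widehat{\mathcal Q}^{-1}_{K_2}$. Finally let $\tau_{1,j}=2\sqrt2\max\{(\mu_{j-1}-\mu_j)^{-1},(\mu_j-\mu_{j+1})^{-1}\}$ and $\tau_{2,j}=2\sqrt2\max\{(\nu_{j-1}-\nu_j)^{-1},(\nu_j-\nu_{j+1})^{-1}\}$,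 where for $j=1$ only the second term of each maximum is present. **Theorem.** Assume (i)–(vii) and, as $T\to\infty$, $$\Big(\sum_{j=1}^{K_1}\mu_j\tau_{1,j}\Big)\Big(\sum_{j=1}^{K_2}\tau_{2,j}\Big)=o\big(T^{1/2}\log^{-3/2}T\big)\ \text{a.s.},\qquad \Big(\sum_{j=K_1+1}^{\infty}\mu_j\Big)\Big(\sum_{j=1}^{K_2}\tau_{2,j}\Big)=o(1)\ \text{a.s.},$$ $\alpha_1\alpha_2^{-1}\to0$ and $\alpha_1^{-1}T^{-1}\log T\to0$. Then $\|\widetilde{\mathcal A}-\mathcal A\|_{op}\to0$ almost surely. -/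

import Mathlib

open MeasureTheory Filter Topology Asymptotics
open scoped ENNReal

noncomputable section

namespace FIV

/-! ### Operators on a real Hilbert space -/

section Operators

variable {H : Type*} [NormedAddCommGroup H] [InnerProductSpace ℝ H]

/-- The tensor product of two vectors: `a ⊗ b` is the operator `ζ ↦ ⟪a, ζ⟫ b`. -/
def tens (a b : H) : H →L[ℝ] H := InnerProductSpace.rankOne ℝ b a

theorem tens_apply (a b ζ : H) : tens a b ζ = inner ℝ a ζ • b := rfl

/-- `T = ∑ⱼ lam j • e j ⊗ e j` is a spectral decomposition of the (compact, self-adjoint,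
nonnegative) operator `T`: the eigenvalues are listed in nonincreasing order with multiplicity, and
the eigenvectors are orthonormal. The first eigenvalue is `lam 0`. -/
structure IsEigenSystem (T : H →L[ℝ] H) (lam : ℕ → ℝ) (e : ℕ → H) : Prop where
  orthonormal : Orthonormal ℝ e
  antitone : Antitone lam
  nonneg : ∀ j, 0 ≤ lam j
  tendsto_zero : Tendsto lam atTop (𝓝 0)
  hasSum : HasSum (fun j => lam j • tens (e j) (e j)) T

/-- The number of indices `j` with `(lam j)² > α`. -/
def numAbove (lam : ℕ → ℝ) (α : ℝ) : ℕ := Set.ncard {j | α < lam j ^ 2}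

/-- The regularized inverse based on the first `K` eigenelements. -/
def regInv (lam : ℕ → ℝ) (e : ℕ → H) (K : ℕ) : H →L[ℝ] H :=
  ∑ j ∈ Finset.range K, (lam j)⁻¹ • tens (e j) (e j)

/-- The reciprocal spectral gaps
`τ_j = 2√2 max {(lam_{j-1} - lam_j)⁻¹, (lam_j - lam_{j+1})⁻¹}`; for the first eigenvalue only the
gap to the second one is present. -/
def tau (lam : ℕ → ℝ) : ℕ → ℝ
  | 0 => 2 * √2 * (lam 0 - lam 1)⁻¹
  | j + 1 => 2 * √2 * max (lam j - lam (j + 1))⁻¹ (lam (j + 1) - lam (j + 2))⁻¹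

theorem parseval_enorm {ι : Type*} (b : HilbertBasis ι ℝ H) (v : H) :
    ∑' i, ‖inner ℝ v (b i)‖ₑ ^ 2 = ‖v‖ₑ ^ 2 := by
  have h := b.hasSum_inner_mul_inner v v
  have h2 : HasSum (fun i => ‖inner ℝ v (b i)‖ ^ 2) (‖v‖ ^ 2) := by
    rw [← real_inner_self_eq_norm_sq]
    refine h.congr_fun ?_ |> fun h => h
    intro i
    rw [real_inner_comm v (b i), Real.norm_eq_abs, sq_abs, sq]
  have h3 := ENNReal.ofReal_tsum_of_nonneg (fun i => sq_nonneg ‖inner ℝ v (b i)‖) h2.summable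
  rw [h2.tsum_eq] at h3
  simp only [ENNReal.ofReal_pow (norm_nonneg _), ofReal_norm] at h3
  exact h3.symm

variable [CompleteSpace H]

/-- An orthonormal basis of `H`, used to write down Hilbert–Schmidt norms and inner products,
which do not depend on it (see `hsNormSq_eq` and `hsInner_eq`). -/
def someBasis (H : Type*) [NormedAddCommGroup H] [InnerProductSpace ℝ H] [CompleteSpace H] :
    HilbertBasis (exists_hilbertBasis ℝ H).choose ℝ H :=
  (exists_hilbertBasis ℝ H).choose_spec.choose

/-- The square of the Hilbert–Schmidt norm, with value `∞` if `T` is not Hilbert–Schmidt. -/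
def hsNormSq (T : H →L[ℝ] H) : ℝ≥0∞ := ∑' i, ‖T (someBasis H i)‖ₑ ^ 2

/-- The Hilbert–Schmidt norm, with value `∞` if `T` is not Hilbert–Schmidt. -/
def hsNorm (T : H →L[ℝ] H) : ℝ≥0∞ := hsNormSq T ^ (1 / 2 : ℝ)

/-- `T` is a Hilbert–Schmidt operator. -/
def IsHS (T : H →L[ℝ] H) : Prop := hsNorm T < ∞

/-- The Hilbert–Schmidt inner product of two Hilbert–Schmidt operators. -/
def hsInner (S T : H →L[ℝ] H) : ℝ := ∑' i, inner ℝ (S (someBasis H i)) (T (someBasis H i))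

/-- `C_xz^* C_zz⁻¹ C_xz` for `C_zz = ∑ⱼ μ j • g j ⊗ g j`, where `C_zz⁻¹ = ∑ⱼ (μ j)⁻¹ • g j ⊗ g j`
is the unbounded inverse. -/
def popQ (Cxz : H →L[ℝ] H) (μ : ℕ → ℝ) (g : ℕ → H) : H →L[ℝ] H :=
  ∑' j, ContinuousLinearMap.adjoint Cxz ∘L ((μ j)⁻¹ • tens (g j) (g j)) ∘L Cxz

theorem tsum_enorm_adjoint {ι κ : Type*} (b : HilbertBasis ι ℝ H) (c : HilbertBasis κ ℝ H)
    (T : H →L[ℝ] H) :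
    ∑' i, ‖T (c i)‖ₑ ^ 2 = ∑' j, ‖ContinuousLinearMap.adjoint T (b j)‖ₑ ^ 2 := by
  calc ∑' i, ‖T (c i)‖ₑ ^ 2 = ∑' i, ∑' j, ‖inner ℝ (T (c i)) (b j)‖ₑ ^ 2 :=
        tsum_congr fun i => (parseval_enorm b _).symm
    _ = ∑' j, ∑' i, ‖inner ℝ (T (c i)) (b j)‖ₑ ^ 2 := ENNReal.tsum_comm
    _ = _ := tsum_congr fun j => by
        rw [← parseval_enorm c]
        refine tsum_congr fun i => ?_
        rw [← ContinuousLinearMap.adjoint_inner_right, real_inner_comm]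

/-- The Hilbert–Schmidt norm may be computed in any orthonormal basis. -/
theorem hsNormSq_eq {ι : Type*} (b : HilbertBasis ι ℝ H) (T : H →L[ℝ] H) :
    hsNormSq T = ∑' i, ‖T (b i)‖ₑ ^ 2 := by
  rw [hsNormSq, tsum_enorm_adjoint b (someBasis H) T, tsum_enorm_adjoint b b T]

theorem isHS_iff (T : H →L[ℝ] H) : IsHS T ↔ hsNormSq T < ∞ := by
  rw [IsHS, hsNorm, ENNReal.rpow_lt_top_iff_of_pos (by norm_num)]

theorem hasSum_normSq {ι : Type*} (b : HilbertBasis ι ℝ H) {T : H →L[ℝ] H} (hT : IsHS T) :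
    HasSum (fun i => ‖T (b i)‖ ^ 2) (hsNormSq T).toReal := by
  rw [isHS_iff, hsNormSq_eq b] at hT
  rw [hsNormSq_eq b]
  have h := ENNReal.hasSum_toReal hT.ne
  rw [ENNReal.tsum_toReal_eq fun i => ?_]
  · simpa only [ENNReal.toReal_pow, toReal_enorm] using h
  · exact ENNReal.pow_ne_top enorm_ne_top

theorem IsHS.add {S T : H →L[ℝ] H} (hS : IsHS S) (hT : IsHS T) : IsHS (S + T) := by
  rw [isHS_iff] at *
  have : hsNormSq (S + T) ≤ 2 * (hsNormSq S + hsNormSq T) := by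
    rw [hsNormSq, hsNormSq, hsNormSq, ← ENNReal.tsum_add, ← ENNReal.tsum_mul_left]
    refine ENNReal.tsum_le_tsum fun i => ?_
    set a := S (someBasis H i)
    set c := T (someBasis H i)
    have h1 : ‖a + c‖ ^ 2 ≤ 2 * (‖a‖ ^ 2 + ‖c‖ ^ 2) := by
      nlinarith [norm_add_le a c, norm_nonneg (a + c), sq_nonneg (‖a‖ - ‖c‖), norm_nonneg a,
        norm_nonneg c]
    have h2 := ENNReal.ofReal_le_ofReal h1
    rw [ENNReal.ofReal_mul (by norm_num), ENNReal.ofReal_add (by positivity) (by positivity),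
      ENNReal.ofReal_pow (norm_nonneg _), ENNReal.ofReal_pow (norm_nonneg _),
      ENNReal.ofReal_pow (norm_nonneg _), ofReal_norm, ofReal_norm, ofReal_norm] at h2
    simpa using h2
  exact this.trans_lt (ENNReal.mul_lt_top (by norm_num) (ENNReal.add_lt_top.2 ⟨hS, hT⟩))

theorem IsHS.neg {T : H →L[ℝ] H} (hT : IsHS T) : IsHS (-T) := by
  rw [isHS_iff] at *
  simpa [hsNormSq] using hT

theorem hasSum_hsInner {ι : Type*} (b : HilbertBasis ι ℝ H) {S T : H →L[ℝ] H} (hS : IsHS S)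
    (hT : IsHS T) : HasSum (fun i => inner ℝ (S (b i)) (T (b i)))
      (((hsNormSq (S + T)).toReal - (hsNormSq (S + -T)).toReal) / 4) := by
  have h := ((hasSum_normSq b (hS.add hT)).sub (hasSum_normSq b (hS.add hT.neg))).div_const 4
  refine h.congr_fun (fun i => ?_) |> fun h => h
  have h1 := norm_add_sq_real (S (b i)) (T (b i))
  have h2 := norm_sub_sq_real (S (b i)) (T (b i))
  have h3 : (S + T) (b i) = S (b i) + T (b i) := rfl
  have h4 : (S + -T) (b i) = S (b i) - T (b i) := (sub_eq_add_neg _ _).symm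
  rw [h3, h4]
  linarith

/-- The Hilbert–Schmidt inner product may be computed in any orthonormal basis. -/
theorem hsInner_eq {ι : Type*} (b : HilbertBasis ι ℝ H) {S T : H →L[ℝ] H} (hS : IsHS S)
    (hT : IsHS T) : hsInner S T = ∑' i, inner ℝ (S (b i)) (T (b i)) := by
  rw [hsInner, (hasSum_hsInner _ hS hT).tsum_eq, (hasSum_hsInner b hS hT).tsum_eq]

end Operators

/-! ### Probability -/

section Probability

variable {Ω : Type*} [MeasurableSpace Ω]

/-- `X_T = O_p(a_T)` for `[0, ∞]`-valued `X_T` and real `a_T`. -/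
def IsBigOp (P : Measure Ω) (X : ℕ → Ω → ℝ≥0∞) (a : ℕ → ℝ) : Prop :=
  ∀ ε : ℝ≥0∞, 0 < ε → ∃ M : ℝ, ∀ᶠ T in atTop, P {ω | ENNReal.ofReal (M * a T) < X T ω} ≤ ε

/-- `X_T = o_p(1)` for `[0, ∞]`-valued `X_T`. -/
def IsLittleOpOne (P : Measure Ω) (X : ℕ → Ω → ℝ≥0∞) : Prop :=
  ∀ ε : ℝ, 0 < ε → Tendsto (fun T => P {ω | ENNReal.ofReal ε < X T ω}) atTop (𝓝 0)

/-- (Strict) stationarity: the law of the sequence is invariant under the time shift. -/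
def IsStationary {E : Type*} [MeasurableSpace E] (P : Measure Ω) (w : ℕ → Ω → E) : Prop :=
  P.map (fun ω t => w (t + 1) ω) = P.map (fun ω t => w t ω)

/-- The events determined by `w t` for `t ∈ I`. -/
abbrev sigmaOn {E : Type*} [MeasurableSpace E] (w : ℕ → Ω → E) (I : Set ℕ) : MeasurableSpace Ω :=
  ⨆ t ∈ I, MeasurableSpace.comap (w t) inferInstance

/-- Geometric strong mixing: the `α`-mixing coefficients
`sup {|P(S ∩ S') - P(S) P(S')| : S ∈ σ(w_t, t ≤ n), S' ∈ σ(w_t, t ≥ n + k), n}` are at most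
`C ρ ^ k` for some `C` and some `ρ < 1`. -/
def IsGeomStronglyMixing {E : Type*} [MeasurableSpace E] (P : Measure Ω) (w : ℕ → Ω → E) : Prop :=
  ∃ C ρ : ℝ, 0 < ρ ∧ ρ < 1 ∧ ∀ k n : ℕ, ∀ S S' : Set Ω,
    MeasurableSet[sigmaOn w (Set.Iic n)] S → MeasurableSet[sigmaOn w (Set.Ici (n + k))] S' →
      |P.real (S ∩ S') - P.real S * P.real S'| ≤ C * ρ ^ k

variable {H : Type*} [NormedAddCommGroup H] [InnerProductSpace ℝ H]

/-- `σ({z_s}_{s ≤ t}, {e_s}_{s < t})`, the information available just before `e_t` is observed. -/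
abbrev past [MeasurableSpace H] (z e : ℕ → Ω → H) (t : ℕ) : MeasurableSpace Ω :=
  sigmaOn z (Set.Iic t) ⊔ sigmaOn e (Set.Iio t)

/-- The operator `E[a ⊗ b]`. -/
def crossCov (P : Measure Ω) (a b : Ω → H) : H →L[ℝ] H := ∫ ω, tens (a ω) (b ω) ∂P

/-- The operator `T⁻¹ ∑ a_t ⊗ b_t`, the sum being over the first `T` observations, which carry the
time indices `0, …, T - 1`. -/
def sampleCov (a b : ℕ → Ω → H) (T : ℕ) (ω : Ω) : H →L[ℝ] H :=
  (T : ℝ)⁻¹ • ∑ t ∈ Finset.range T, tens (a t ω) (b t ω)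

variable [CompleteSpace H]

/-- For a random Hilbert–Schmidt operator `D` with `E D = 0`: `M` lists the eigenvalues of the
covariance operator `Γ` of `D` as a random element of the Hilbert space of Hilbert–Schmidt
operators, in nonincreasing order, and `E` lists orthonormal eigenvectors, that is
`⟪Γ S, S'⟫ = E[⟪D, S⟫ ⟪D, S'⟫] = ∑ⱼ M j ⟪E j, S⟫ ⟪E j, S'⟫` for all Hilbert–Schmidt `S`, `S'`. -/
structure IsHSCovEigenSystem (P : Measure Ω) (D : Ω → H →L[ℝ] H) (M : ℕ → ℝ)
    (E : ℕ → H →L[ℝ] H) : Prop where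
  isHS : ∀ j, IsHS (E j)
  orthonormal : ∀ i j, hsInner (E i) (E j) = if i = j then 1 else 0
  antitone : Antitone M
  nonneg : ∀ j, 0 ≤ M j
  tendsto_zero : Tendsto M atTop (𝓝 0)
  hasSum : ∀ S S' : H →L[ℝ] H, IsHS S → IsHS S' →
    HasSum (fun j => M j * hsInner (E j) S * hsInner (E j) S')
      (∫ ω, hsInner (D ω) S * hsInner (D ω) S' ∂P)

/-! ### The estimator -/

/-- `Q̂ = Ĉ_xz^* (Ĉ_zz)_{K₁}⁻¹ Ĉ_xz`, where `(μ', g')` are the eigenelements of `Ĉ_zz`. -/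
def sampleQ (x z : ℕ → Ω → H) (μ' : ℕ → ℝ) (g' : ℕ → H) (K₁ T : ℕ) (ω : Ω) : H →L[ℝ] H :=
  ContinuousLinearMap.adjoint (sampleCov x z T ω) ∘L regInv μ' g' K₁ ∘L sampleCov x z T ω

/-- `P̂ = Ĉ_yz^* (Ĉ_zz)_{K₁}⁻¹ Ĉ_xz`. -/
def sampleP (x y z : ℕ → Ω → H) (μ' : ℕ → ℝ) (g' : ℕ → H) (K₁ T : ℕ) (ω : Ω) : H →L[ℝ] H :=
  ContinuousLinearMap.adjoint (sampleCov y z T ω) ∘L regInv μ' g' K₁ ∘L sampleCov x z T ω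

/-- The functional two-stage least squares estimator `P̂ Q̂_{K₂}⁻¹`, where `(μ', g')` and `(ν', h')`
are the eigenelements of `Ĉ_zz` and of `Q̂`. -/
def f2slse (x y z : ℕ → Ω → H) (μ' : ℕ → ℝ) (g' : ℕ → H) (ν' : ℕ → ℝ) (h' : ℕ → H)
    (K₁ K₂ T : ℕ) (ω : Ω) : H →L[ℝ] H :=
  sampleP x y z μ' g' K₁ T ω ∘L regInv ν' h' K₂

/-! ### The assumptions -/

variable [MeasurableSpace H]

/-- The standing assumptions on the functional linear model `y_t = A x_t + u_t` with first stage
`x_t = B z_t + v_t`. The time index starts at `0`; `(μ, g)` and `(ν, h)` are the eigenelements of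
`C_zz` and of `Q = C_xz^* C_zz⁻¹ C_xz`. -/
structure ModelAssumptions (P : Measure Ω) (A B : H →L[ℝ] H) (x y z u v : ℕ → Ω → H)
    (μ : ℕ → ℝ) (g : ℕ → H) (ν : ℕ → ℝ) (h : ℕ → H) : Prop where
  measurable_x : ∀ t, Measurable (x t)
  measurable_y : ∀ t, Measurable (y t)
  measurable_z : ∀ t, Measurable (z t)
  measurable_u : ∀ t, Measurable (u t)
  measurable_v : ∀ t, Measurable (v t)
  /-- the model -/
  model : ∀ t, ∀ᵐ ω ∂P, y t ω = A (x t ω) + u t ω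
  /-- the first stage -/
  first_stage : ∀ t, ∀ᵐ ω ∂P, x t ω = B (z t ω) + v t ω
  crossCov_zv : ∀ t, crossCov P (z t) (v t) = 0
  memLp_x : ∀ t, MemLp (x t) 2 P
  memLp_z : ∀ t, MemLp (z t) 2 P
  integrable_u : ∀ t, Integrable (u t) P
  mean_x : ∀ t, ∫ ω, x t ω ∂P = 0
  mean_z : ∀ t, ∫ ω, z t ω ∂P = 0
  mean_u : ∀ t, ∫ ω, u t ω ∂P = 0
  mean_v : ∀ t, ∫ ω, v t ω ∂P = 0
  stationary : IsStationary P fun t ω => (x t ω, z t ω)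
  mixing : IsGeomStronglyMixing P fun t ω => (x t ω, z t ω)
  /-- `u_t` is a homoscedastic martingale difference with bounded conditional moments -/
  martingale_u : ∀ t, P[u t | past z u t] =ᵐ[P] 0
  homoscedastic_u : ∀ t, P[fun ω => tens (u t ω) (u t ω) | past z u t]
    =ᵐ[P] fun _ => crossCov P (u 0) (u 0)
  moment_u : ∃ δ : ℝ, 0 < δ ∧ (∀ t, Integrable (fun ω => ‖u t ω‖ ^ (2 + δ)) P) ∧
    ∀ᵐ ω ∂P, BddAbove (Set.range fun t => (P[fun ω => ‖u t ω‖ ^ (2 + δ) | past z u t]) ω)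
  /-- eigenelements of `C_zz`, with distinct positive eigenvalues -/
  eigen_Czz : IsEigenSystem (crossCov P (z 0) (z 0)) μ g
  strictAnti_μ : StrictAnti μ
  pos_μ : ∀ j, 0 < μ j
  /-- eigenelements of `Q`, with distinct positive eigenvalues -/
  eigen_Q : IsEigenSystem (popQ (crossCov P (x 0) (z 0)) μ g) ν h
  strictAnti_ν : StrictAnti ν
  pos_ν : ∀ j, 0 < ν j
  /-- identification -/
  ker_Q : ∀ ζ, popQ (crossCov P (x 0) (z 0)) μ g ζ = 0 → ζ = 0
  isHS_A : IsHS A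
  /-- weak convergence rates of the sample operators -/
  rate_xz : IsBigOp P (fun T ω => hsNorm (sampleCov x z T ω - crossCov P (x 0) (z 0)))
    fun T => (T : ℝ) ^ (-1 / 2 : ℝ)
  rate_zz : IsBigOp P (fun T ω => hsNorm (sampleCov z z T ω - crossCov P (z 0) (z 0)))
    fun T => (T : ℝ) ^ (-1 / 2 : ℝ)
  rate_uz : IsBigOp P (fun T ω => hsNorm (sampleCov u z T ω - crossCov P (u 0) (z 0)))
    fun T => (T : ℝ) ^ (-1 / 2 : ℝ)
  rate_vz : IsBigOp P (fun T ω => hsNorm (sampleCov v z T ω)) fun T => (T : ℝ) ^ (-1 / 2 : ℝ)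
  rate_uu : IsLittleOpOne P fun T ω => hsNorm (sampleCov u u T ω - crossCov P (u 0) (u 0))

/-- The additional assumptions for strong consistency: bounded variables, geometrically decaying
eigenvalues of the covariance operator of `z_t ⊗ z_t - C_zz`, and either the martingale difference
property of `v_t` or an almost sure rate for `Ĉ_vz`. -/
structure StrongAssumptions (P : Measure Ω) (x z u v : ℕ → Ω → H) : Prop where
  bounded_x : ∃ m : ℝ, ∀ᵐ ω ∂P, ∀ t, ‖x t ω‖ ≤ m
  bounded_z : ∃ m : ℝ, ∀ᵐ ω ∂P, ∀ t, ‖z t ω‖ ≤ m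
  bounded_u : ∃ m : ℝ, ∀ᵐ ω ∂P, ∀ t, ‖u t ω‖ ≤ m
  decay : ∃ (M : ℕ → ℝ) (E : ℕ → H →L[ℝ] H),
    IsHSCovEigenSystem P (fun ω => tens (z 0 ω) (z 0 ω) - crossCov P (z 0) (z 0)) M E ∧
    ∃ a b : ℝ, 0 < a ∧ 0 < b ∧ b < 1 ∧ ∀ j, M j ≤ a * b ^ (j + 1)
  martingale_or_rate : (∀ t, P[v t | past z v t] =ᵐ[P] 0) ∨
    ∀ᵐ ω ∂P, (fun T : ℕ => ‖sampleCov v z T ω‖) =O[atTop]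
      fun T : ℕ => (T : ℝ) ^ (-1 / 2 : ℝ) * Real.log T

end Probability

end FIV

end

/-!
Since `y = A x + u`, the error of the estimator splits as `Ã - A = A (Π̂ - 1) + N̂`, where `Π̂` is
the spectral projection of `Q̂` that is retained by the second regularization and `N̂` is the
contribution of `Ĉ_uz`. Substituting `Ĉ_xz = Ĉ_zz B^* + Ĉ_vz` shows that `Q̂` tends in operator norm
to the injective operator `Q = B C_zz B^*`, almost surely.

* Bias: vectors `Q ζ` are nearly fixed by `Π̂`, and the range of `Q` is dense, so `Π̂` tends
  strongly to the identity. As `A` is Hilbert–Schmidt, `A (Π̂ - 1)` then tends to `0` in operator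
  norm.
* Noise: as `Q̂` is itself the sandwich `Ĉ_xz^* (Ĉ_zz)_{K₁}⁻¹ Ĉ_xz`, one has
  `‖N̂‖ ^ 2 ≤ ‖Ĉ_uz‖ ^ 2 / (√α₁ √α₂)`. The sums `∑ u_t ⊗ z_t` form a Hilbert space valued martingale
  with bounded increments, so their fourth moments grow quadratically; the maximal inequality and
  the Borel–Cantelli lemma along dyadic blocks yield `‖Ĉ_uz‖ ^ 2 = O(T⁻¹ log T)`.

The strong law for `Ĉ_zz` holds because bounded functions of `z_t` at distant times are almost
uncorrelated, by strong mixing.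
-/

namespace FIV

section DiagonalOperators

variable {H : Type*} [NormedAddCommGroup H] [InnerProductSpace ℝ H]

/-- The diagonal operator `∑_{j < K} c j • e j ⊗ e j`, of which the regularized inverses and the
spectral projections are special cases. -/
noncomputable def partialDiag (c : ℕ → ℝ) (e : ℕ → H) (K : ℕ) : H →L[ℝ] H :=
  ∑ j ∈ Finset.range K, c j • tens (e j) (e j)

/-- The orthogonal projection on the span of the first `K` vectors of an orthonormal sequence `e`,
written as a diagonal operator. -/
noncomputable abbrev spanProj (e : ℕ → H) (K : ℕ) : H →L[ℝ] H := partialDiag 1 e K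

theorem regInv_eq_partialDiag (lam : ℕ → ℝ) (e : ℕ → H) (K : ℕ) :
    regInv lam e K = partialDiag (fun j => (lam j)⁻¹) e K := rfl

theorem partialDiag_apply (c : ℕ → ℝ) (e : ℕ → H) (K : ℕ) (w : H) :
    partialDiag c e K w = ∑ j ∈ Finset.range K, (c j * inner ℝ (e j) w) • e j := by
  simp [partialDiag, tens_apply, smul_smul]

theorem partialDiag_congr {c d : ℕ → ℝ} {e : ℕ → H} {K : ℕ} (h : ∀ j < K, c j = d j) :
    partialDiag c e K = partialDiag d e K :=
  Finset.sum_congr rfl fun j hj => by rw [h j (Finset.mem_range.1 hj)]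

theorem partialDiag_sub_partialDiag (c : ℕ → ℝ) (e : ℕ → H) {K n : ℕ} (hKn : K ≤ n) :
    partialDiag c e n - partialDiag c e K
      = partialDiag (fun j => if j < K then 0 else c j) e n := by
  rw [partialDiag, partialDiag, partialDiag, ← Finset.sum_Ico_eq_sub _ hKn,
    ← Finset.sum_range_add_sum_Ico _ hKn, Finset.sum_eq_zero (s := Finset.range K), zero_add]
  · exact Finset.sum_congr rfl fun j hj => by rw [if_neg (Finset.mem_Ico.1 hj).1.not_gt]
  · exact fun j hj => by rw [if_pos (Finset.mem_range.1 hj), zero_smul]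

theorem inner_partialDiag_apply (c : ℕ → ℝ) (e : ℕ → H) (K : ℕ) (w : H) :
    inner ℝ (partialDiag c e K w) w = ∑ j ∈ Finset.range K, c j * inner ℝ (e j) w ^ 2 := by
  rw [partialDiag_apply, sum_inner]
  refine Finset.sum_congr rfl fun j _ => ?_
  rw [real_inner_smul_left]
  ring

theorem norm_partialDiag_apply_sq {e : ℕ → H} (he : Orthonormal ℝ e) (c : ℕ → ℝ) (K : ℕ)
    (w : H) :
    ‖partialDiag c e K w‖ ^ 2 = ∑ j ∈ Finset.range K, c j ^ 2 * inner ℝ (e j) w ^ 2 := by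
  rw [← real_inner_self_eq_norm_sq, partialDiag_apply, he.inner_sum]
  refine Finset.sum_congr rfl fun j _ => ?_
  simp only [conj_trivial]
  ring

theorem norm_partialDiag_apply_sq_le_inner {e : ℕ → H} (he : Orthonormal ℝ e) {c : ℕ → ℝ} {K : ℕ}
    {M : ℝ} (h0 : ∀ j < K, 0 ≤ c j) (hM : ∀ j < K, c j ≤ M) (w : H) :
    ‖partialDiag c e K w‖ ^ 2 ≤ M * inner ℝ (partialDiag c e K w) w := by
  rw [norm_partialDiag_apply_sq he, inner_partialDiag_apply, Finset.mul_sum]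
  refine Finset.sum_le_sum fun j hj => ?_
  have hj := Finset.mem_range.1 hj
  rw [← mul_assoc, sq]
  exact mul_le_mul_of_nonneg_right (mul_le_mul_of_nonneg_right (hM j hj) (h0 j hj)) (sq_nonneg _)

theorem norm_partialDiag_le {e : ℕ → H} (he : Orthonormal ℝ e) {c : ℕ → ℝ} {K : ℕ} {M : ℝ}
    (hM0 : 0 ≤ M) (hM : ∀ j < K, |c j| ≤ M) : ‖partialDiag c e K‖ ≤ M := by
  refine ContinuousLinearMap.opNorm_le_bound _ hM0 fun w =>
    le_of_sq_le_sq ?_ (by positivity)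
  calc ‖partialDiag c e K w‖ ^ 2 = ∑ j ∈ Finset.range K, c j ^ 2 * inner ℝ (e j) w ^ 2 :=
        norm_partialDiag_apply_sq he c K w
    _ ≤ ∑ j ∈ Finset.range K, M ^ 2 * inner ℝ (e j) w ^ 2 := by
        refine Finset.sum_le_sum fun j hj => mul_le_mul_of_nonneg_right ?_ (sq_nonneg _)
        exact sq_le_sq.2 ((hM j (Finset.mem_range.1 hj)).trans (le_abs_self M))
    _ = M ^ 2 * ∑ j ∈ Finset.range K, ‖inner ℝ (e j) w‖ ^ 2 := by
        simp only [Finset.mul_sum, Real.norm_eq_abs, sq_abs]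
    _ ≤ M ^ 2 * ‖w‖ ^ 2 := by
        gcongr
        exact he.sum_inner_products_le w
    _ = (M * ‖w‖) ^ 2 := (mul_pow _ _ _).symm

theorem norm_spanProj_le {e : ℕ → H} (he : Orthonormal ℝ e) (K : ℕ) : ‖spanProj e K‖ ≤ 1 :=
  norm_partialDiag_le he zero_le_one fun _ _ => abs_one.le

theorem norm_sub_spanProj_apply_le {e : ℕ → H} (he : Orthonormal ℝ e) (K : ℕ) (w : H) :
    ‖w - spanProj e K w‖ ≤ ‖w‖ := by
  have hinner : inner ℝ w (spanProj e K w) = ‖spanProj e K w‖ ^ 2 := by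
    rw [real_inner_comm, inner_partialDiag_apply, norm_partialDiag_apply_sq he]
    simp only [Pi.one_apply, one_pow]
  refine le_of_sq_le_sq ?_ (norm_nonneg w)
  rw [norm_sub_sq_real, hinner]
  linarith [sq_nonneg ‖spanProj e K w‖]

end DiagonalOperators

section EigenSystems

variable {H : Type*} [NormedAddCommGroup H] [InnerProductSpace ℝ H]
  {T : H →L[ℝ] H} {lam : ℕ → ℝ} {e : ℕ → H} {α : ℝ}

theorem IsEigenSystem.tendsto_partialDiag (h : IsEigenSystem T lam e) :
    Tendsto (partialDiag lam e) atTop (𝓝 T) := h.hasSum.tendsto_sum_nat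

theorem IsEigenSystem.apply_eq (h : IsEigenSystem T lam e) (k : ℕ) : T (e k) = lam k • e k := by
  refine (h.hasSum.mapL (ContinuousLinearMap.apply ℝ H (e k))).unique ?_
  convert hasSum_single k fun j hj => ?_ using 1
  · simp [tens_apply, h.orthonormal.1 k]
  · simp [tens_apply, h.orthonormal.2 hj]

theorem IsEigenSystem.comp_partialDiag (h : IsEigenSystem T lam e) (c : ℕ → ℝ) (K : ℕ) :
    T ∘L partialDiag c e K = partialDiag (fun j => lam j * c j) e K := by
  ext w
  rw [ContinuousLinearMap.comp_apply, partialDiag_apply, partialDiag_apply, map_sum]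
  refine Finset.sum_congr rfl fun j _ => ?_
  rw [map_smul, h.apply_eq, smul_smul]
  congr 1
  ring

theorem IsEigenSystem.norm_sub_partialDiag_le (h : IsEigenSystem T lam e) {K : ℕ} {s : ℝ}
    (hs0 : 0 ≤ s) (hs : ∀ j, K ≤ j → lam j ≤ s) : ‖T - partialDiag lam e K‖ ≤ s := by
  refine le_of_tendsto (h.tendsto_partialDiag.sub_const _).norm ?_
  filter_upwards [eventually_ge_atTop K] with n hn
  rw [partialDiag_sub_partialDiag _ _ hn]
  refine norm_partialDiag_le h.orthonormal hs0 fun j _ => ?_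
  split_ifs with hj
  · rwa [abs_zero]
  · rw [abs_of_nonneg (h.nonneg j)]
    exact hs j (not_lt.1 hj)

theorem IsEigenSystem.lt_numAbove_iff (h : IsEigenSystem T lam e) (hα : 0 < α) {j : ℕ} :
    j < numAbove lam α ↔ √α < lam j := by
  have hlt : ∀ i, α < lam i ^ 2 ↔ √α < lam i := fun i =>
    (Real.sqrt_lt_sqrt_iff hα.le).symm.trans (by rw [Real.sqrt_sq (h.nonneg i)])
  have hlower : IsLowerSet {i | α < lam i ^ 2} := fun i k hki hi =>
    hi.trans_le (pow_le_pow_left₀ (h.nonneg i) (h.antitone hki) 2)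
  have hne : {i | α < lam i ^ 2} ≠ Set.univ := fun huniv => by
    obtain ⟨i, hi⟩ :=
      (h.tendsto_zero.eventually_lt_const (Real.sqrt_pos.2 hα)).exists
    exact hi.not_gt ((hlt i).1 (Set.eq_univ_iff_forall.1 huniv i))
  obtain ⟨n, hn⟩ := hlower.eq_univ_or_Iio.resolve_left hne
  rw [← hlt, numAbove, hn, Set.ncard_Iio_nat]
  exact (Set.ext_iff.1 hn j).symm

theorem IsEigenSystem.comp_regInv (h : IsEigenSystem T lam e) (hα : 0 < α) :
    T ∘L regInv lam e (numAbove lam α) = spanProj e (numAbove lam α) := by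
  rw [regInv_eq_partialDiag, h.comp_partialDiag]
  refine partialDiag_congr fun j hj => mul_inv_cancel₀ ?_
  exact ((Real.sqrt_nonneg α).trans_lt ((h.lt_numAbove_iff hα).1 hj)).ne'

theorem IsEigenSystem.inv_le_of_lt_numAbove (h : IsEigenSystem T lam e) (hα : 0 < α) {j : ℕ}
    (hj : j < numAbove lam α) : (lam j)⁻¹ ≤ (√α)⁻¹ :=
  inv_anti₀ (Real.sqrt_pos.2 hα) ((h.lt_numAbove_iff hα).1 hj).le

theorem IsEigenSystem.norm_regInv_le (h : IsEigenSystem T lam e) (hα : 0 < α) :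
    ‖regInv lam e (numAbove lam α)‖ ≤ (√α)⁻¹ :=
  norm_partialDiag_le h.orthonormal (by positivity) fun j hj => by
    rw [abs_of_nonneg (inv_nonneg.2 (h.nonneg j))]
    exact h.inv_le_of_lt_numAbove hα hj

theorem IsEigenSystem.norm_regInv_apply_sq_le (h : IsEigenSystem T lam e) (hα : 0 < α) (w : H) :
    ‖regInv lam e (numAbove lam α) w‖ ^ 2
      ≤ (√α)⁻¹ * inner ℝ (regInv lam e (numAbove lam α) w) w :=
  norm_partialDiag_apply_sq_le_inner h.orthonormal (fun j _ => inv_nonneg.2 (h.nonneg j))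
    (fun _ hj => h.inv_le_of_lt_numAbove hα hj) w

theorem IsEigenSystem.norm_sub_comp_spanProj_le (h : IsEigenSystem T lam e) (hα : 0 < α) :
    ‖T - T ∘L spanProj e (numAbove lam α)‖ ≤ √α := by
  rw [h.comp_partialDiag]
  simp only [Pi.one_apply, mul_one]
  exact h.norm_sub_partialDiag_le (Real.sqrt_nonneg _) fun j hj =>
    not_lt.1 ((h.lt_numAbove_iff hα).not.1 hj.not_gt)

variable [CompleteSpace H]

open ContinuousLinearMap (adjoint)

theorem adjoint_tens (a b : H) : adjoint (tens a b) = tens b a :=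
  InnerProductSpace.adjoint_rankOne b a

theorem norm_adjoint (T : H →L[ℝ] H) : ‖adjoint T‖ = ‖T‖ := LinearIsometryEquiv.norm_map _ T

theorem adjoint_partialDiag (c : ℕ → ℝ) (e : ℕ → H) (K : ℕ) :
    adjoint (partialDiag c e K) = partialDiag c e K := by
  simp [partialDiag, adjoint_tens]

theorem IsEigenSystem.adjoint_eq (h : IsEigenSystem T lam e) : adjoint T = T := by
  have hadj := ((adjoint (𝕜 := ℝ) (E := H) (F := H)).continuous.tendsto T).comp
    h.tendsto_partialDiag
  refine tendsto_nhds_unique (hadj.congr fun n => ?_) h.tendsto_partialDiag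
  exact adjoint_partialDiag lam e n

theorem IsEigenSystem.regInv_comp (h : IsEigenSystem T lam e) (hα : 0 < α) :
    regInv lam e (numAbove lam α) ∘L T = spanProj e (numAbove lam α) := by
  have := congrArg adjoint (h.comp_regInv hα)
  rwa [ContinuousLinearMap.adjoint_comp, h.adjoint_eq, regInv_eq_partialDiag, adjoint_partialDiag,
    adjoint_partialDiag] at this

theorem IsEigenSystem.norm_sub_spanProj_comp_le (h : IsEigenSystem T lam e) (hα : 0 < α) :
    ‖T - spanProj e (numAbove lam α) ∘L T‖ ≤ √α := by
  have := h.norm_sub_comp_spanProj_le hα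
  rwa [← norm_adjoint, map_sub, ContinuousLinearMap.adjoint_comp, h.adjoint_eq,
    adjoint_partialDiag] at this

end EigenSystems

section HilbertSchmidt

variable {ι H : Type*} {l : Filter ι} [NormedAddCommGroup H] [InnerProductSpace ℝ H]
  [CompleteSpace H]

open ContinuousLinearMap (adjoint)

theorem IsHS.isHS_adjoint {T : H →L[ℝ] H} (hT : IsHS T) : IsHS (adjoint T) := by
  rw [isHS_iff] at *
  rwa [hsNormSq, ← tsum_enorm_adjoint (someBasis H) (someBasis H)]

theorem IsHS.clm_comp {T : H →L[ℝ] H} (hT : IsHS T) (L : H →L[ℝ] H) : IsHS (L ∘L T) := by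
  rw [isHS_iff] at *
  calc hsNormSq (L ∘L T) ≤ ∑' i, ‖L‖ₑ ^ 2 * ‖T (someBasis H i)‖ₑ ^ 2 :=
        ENNReal.tsum_le_tsum fun i => by
          rw [← mul_pow]
          exact pow_le_pow_left₀ zero_le (L.le_opENorm _) 2
    _ = ‖L‖ₑ ^ 2 * hsNormSq T := ENNReal.tsum_mul_left
    _ < ∞ := ENNReal.mul_lt_top (ENNReal.pow_lt_top enorm_lt_top) hT

theorem IsHS.norm_sq_le_hsNormSq {T : H →L[ℝ] H} (hT : IsHS T) :
    ‖T‖ ^ 2 ≤ (hsNormSq T).toReal := by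
  refine (Real.le_sqrt (norm_nonneg T) ENNReal.toReal_nonneg).1 ?_
  rw [← norm_adjoint]
  refine ContinuousLinearMap.opNorm_le_bound _ (Real.sqrt_nonneg _) fun ζ =>
    le_of_sq_le_sq ?_ (by positivity)
  rw [mul_pow, Real.sq_sqrt ENNReal.toReal_nonneg, ← real_inner_self_eq_norm_sq]
  refine hasSum_le (fun i => ?_) ((someBasis H).hasSum_inner_mul_inner _ _)
    ((hasSum_normSq (someBasis H) hT).mul_right (‖ζ‖ ^ 2))
  rw [real_inner_comm, ← sq, ContinuousLinearMap.adjoint_inner_right, ← mul_pow]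
  exact sq_le_sq.2 ((abs_real_inner_le_norm _ _).trans (le_abs_self _))

theorem IsHS.tendsto_clm_comp {T : H →L[ℝ] H} (hT : IsHS T) {L : ι → H →L[ℝ] H} {M : ℝ}
    (hM : ∀ i, ‖L i‖ ≤ M) (hL : ∀ w, Tendsto (fun i => L i w) l (𝓝 0)) :
    Tendsto (fun i => L i ∘L T) l (𝓝 0) := by
  obtain ⟨κ, b, -⟩ := exists_hilbertBasis ℝ H
  have hlim : Tendsto (fun i => ∑' j, ‖L i (T (b j))‖ ^ 2) l (𝓝 (∑' _ : κ, 0)) := by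
    refine tendsto_tsum_of_dominated_convergence
      ((hasSum_normSq b hT).summable.mul_left (M ^ 2)) (fun j => ?_)
      (Eventually.of_forall fun i j => ?_)
    · simpa using ((hL (T (b j))).norm).pow 2
    · rw [Real.norm_of_nonneg (by positivity), ← mul_pow]
      gcongr
      exact (L i).le_of_opNorm_le (hM i) _
  rw [tsum_zero] at hlim
  have hsq : Tendsto (fun i => ‖L i ∘L T‖ ^ 2) l (𝓝 0) := by
    refine squeeze_zero (fun _ => sq_nonneg _) (fun i => ?_) hlim
    have hi := hT.clm_comp (L i)
    exact hi.norm_sq_le_hsNormSq.trans_eq (hasSum_normSq b hi).tsum_eq.symm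
  refine tendsto_zero_iff_norm_tendsto_zero.2 ?_
  simpa using hsq.sqrt

theorem IsHS.tendsto_comp_clm {A : H →L[ℝ] H} (hA : IsHS A) {S : ι → H →L[ℝ] H} {S₀ : H →L[ℝ] H}
    {M : ℝ} (hM : ∀ i, ‖S i‖ ≤ M)
    (hS : ∀ w, Tendsto (fun i => adjoint (S i) w) l (𝓝 (adjoint S₀ w))) :
    Tendsto (fun i => A ∘L S i) l (𝓝 (A ∘L S₀)) := by
  have hzero := hA.isHS_adjoint.tendsto_clm_comp (L := fun i => adjoint (S i - S₀)) (M := M + ‖S₀‖)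
    (l := l) (fun i => ?_) fun w => ?_
  · refine tendsto_iff_norm_sub_tendsto_zero.2 ((norm_zero (E := H →L[ℝ] H) ▸ hzero.norm).congr
      fun i => ?_)
    rw [← ContinuousLinearMap.adjoint_comp, norm_adjoint, ContinuousLinearMap.comp_sub]
  · rw [norm_adjoint]
    exact (norm_sub_le _ _).trans (by gcongr; exact hM i)
  · simpa using tendsto_sub_nhds_zero_iff.2 (hS w)

end HilbertSchmidt

section SpectralProjections

variable {ι H : Type*} {l : Filter ι} [NormedAddCommGroup H] [InnerProductSpace ℝ H]
  [CompleteSpace H]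

open ContinuousLinearMap (adjoint)

theorem denseRange_of_adjoint_injective {Q : H →L[ℝ] H} (hQ : ∀ ζ, adjoint Q ζ = 0 → ζ = 0) :
    DenseRange Q := by
  have hclosure : Q.range.topologicalClosure = ⊤ := by
    rw [Submodule.topologicalClosure_eq_top_iff, ContinuousLinearMap.orthogonal_range]
    exact LinearMap.ker_eq_bot'.2 hQ
  exact Submodule.dense_iff_topologicalClosure_eq_top.2 hclosure

theorem tendsto_spanProj_apply {Q : H →L[ℝ] H} (hQ : DenseRange Q) {Q' : ι → H →L[ℝ] H}
    (hlim : Tendsto Q' l (𝓝 Q)) {lam : ι → ℕ → ℝ} {e : ι → ℕ → H}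
    (he : ∀ i, IsEigenSystem (Q' i) (lam i) (e i)) {α : ι → ℝ} (hα : ∀ i, 0 < α i)
    (hα0 : Tendsto α l (𝓝 0)) (w : H) :
    Tendsto (fun i => spanProj (e i) (numAbove (lam i) (α i)) w) l (𝓝 w) := by
  have hequi : Equicontinuous fun i w => spanProj (e i) (numAbove (lam i) (α i)) w :=
    (LipschitzWith.uniformEquicontinuous _ 1 fun i =>
      ContinuousLinearMap.lipschitzWith_of_opNorm_le
        (norm_spanProj_le (he i).orthonormal _)).equicontinuous
  refine hQ.induction_on w (hequi.isClosed_setOfPred_tendsto continuous_id) fun ζ => ?_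
  have hbound : Tendsto (fun i => ‖Q' i - Q‖ * ‖ζ‖ + √(α i) * ‖ζ‖) l (𝓝 0) := by
    simpa using ((tendsto_iff_norm_sub_tendsto_zero.1 hlim).mul_const ‖ζ‖).add
      (hα0.sqrt.mul_const ‖ζ‖)
  refine tendsto_iff_norm_sub_tendsto_zero.2 (squeeze_zero (fun _ => norm_nonneg _) (fun i => ?_)
    hbound)
  set p := spanProj (e i) (numAbove (lam i) (α i))
  calc ‖p (Q ζ) - id (Q ζ)‖ = ‖((Q - Q' i) ζ - p ((Q - Q' i) ζ)) + (Q' i - p ∘L Q' i) ζ‖ := by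
        rw [norm_sub_rev]
        congr 1
        simp only [sub_apply, map_sub, ContinuousLinearMap.comp_apply, id_eq]
        abel
    _ ≤ ‖(Q - Q' i) ζ‖ + √(α i) * ‖ζ‖ := norm_add_le_of_le
        (norm_sub_spanProj_apply_le (he i).orthonormal _ _)
        (ContinuousLinearMap.le_of_opNorm_le _ ((he i).norm_sub_spanProj_comp_le (hα i)) ζ)
    _ ≤ ‖Q' i - Q‖ * ‖ζ‖ + √(α i) * ‖ζ‖ := by
        rw [norm_sub_rev (Q' i)]
        gcongr
        exact (Q - Q' i).le_opNorm ζ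

theorem IsHS.tendsto_comp_spanProj {A Q : H →L[ℝ] H} (hA : IsHS A) (hQ : DenseRange Q)
    {Q' : ι → H →L[ℝ] H} (hlim : Tendsto Q' l (𝓝 Q)) {lam : ι → ℕ → ℝ} {e : ι → ℕ → H}
    (he : ∀ i, IsEigenSystem (Q' i) (lam i) (e i)) {α : ι → ℝ} (hα : ∀ i, 0 < α i)
    (hα0 : Tendsto α l (𝓝 0)) :
    Tendsto (fun i => A ∘L spanProj (e i) (numAbove (lam i) (α i))) l (𝓝 A) := by
  have h := hA.tendsto_comp_clm (S₀ := ContinuousLinearMap.id ℝ H) (l := l)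
    (fun i => norm_spanProj_le (he i).orthonormal (numAbove (lam i) (α i))) fun w => by
      simpa only [adjoint_partialDiag, ContinuousLinearMap.adjoint_id, ContinuousLinearMap.id_apply]
        using tendsto_spanProj_apply hQ hlim he hα hα0 w
  rwa [ContinuousLinearMap.comp_id] at h

end SpectralProjections

section Regularization

variable {ι H : Type*} {l : Filter ι} [NormedAddCommGroup H] [InnerProductSpace ℝ H]
  {A B C C' U V X : H →L[ℝ] H} {lam lam' : ℕ → ℝ} {e e' : ℕ → H} {α α' : ℝ}

open ContinuousLinearMap (adjoint)

theorem norm_comp_comp_le {R S T : H →L[ℝ] H} {s : ℝ} (hS : ‖S‖ ≤ s) :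
    ‖R ∘L S ∘L T‖ ≤ ‖R‖ * s * ‖T‖ :=
  calc ‖R ∘L S ∘L T‖ ≤ ‖R‖ * (‖S‖ * ‖T‖) :=
        (R.opNorm_comp_le _).trans (by gcongr; exact S.opNorm_comp_le T)
    _ ≤ ‖R‖ * s * ‖T‖ := by
        rw [← mul_assoc]
        gcongr

variable [CompleteSpace H]

theorem IsEigenSystem.sandwich_sub_eq (h : IsEigenSystem C' lam e) (hα : 0 < α)
    (hX : X = C' ∘L adjoint B + V) :
    adjoint X ∘L regInv lam e (numAbove lam α) ∘L X - B ∘L C ∘L adjoint B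
      = B ∘L ((C' - C) - (C' - C' ∘L spanProj e (numAbove lam α))) ∘L adjoint B
        + B ∘L spanProj e (numAbove lam α) ∘L V
        + adjoint V ∘L spanProj e (numAbove lam α) ∘L adjoint B
        + adjoint V ∘L regInv lam e (numAbove lam α) ∘L V := by
  have hadj : adjoint X = B ∘L C' + adjoint V := by
    rw [hX, map_add, ContinuousLinearMap.adjoint_comp, h.adjoint_eq,
      ContinuousLinearMap.adjoint_adjoint]
  have hleft : ∀ ζ, C' (regInv lam e (numAbove lam α) ζ) = spanProj e (numAbove lam α) ζ :=
    DFunLike.congr_fun (h.comp_regInv hα)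
  have hright : ∀ ζ, regInv lam e (numAbove lam α) (C' ζ) = spanProj e (numAbove lam α) ζ :=
    DFunLike.congr_fun (h.regInv_comp hα)
  rw [hadj, hX]
  ext ζ
  simp only [sub_apply, add_apply, ContinuousLinearMap.comp_apply, map_add, map_sub, hleft, hright]
  abel

theorem IsEigenSystem.norm_sandwich_sub_le (h : IsEigenSystem C' lam e) (hα : 0 < α)
    (hX : X = C' ∘L adjoint B + V) :
    ‖adjoint X ∘L regInv lam e (numAbove lam α) ∘L X - B ∘L C ∘L adjoint B‖
      ≤ ‖B‖ * (‖C' - C‖ + √α) * ‖B‖ + 2 * (‖B‖ * ‖V‖) + ‖V‖ ^ 2 * (√α)⁻¹ := by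
  have hmain := norm_comp_comp_le (R := B) (T := adjoint B)
    (norm_sub_le_of_le le_rfl (h.norm_sub_comp_spanProj_le hα) :
      ‖(C' - C) - (C' - C' ∘L spanProj e (numAbove lam α))‖ ≤ ‖C' - C‖ + √α)
  have hproj := norm_spanProj_le h.orthonormal (numAbove lam α)
  have hBV := norm_comp_comp_le (R := B) (T := V) hproj
  have hVB := norm_comp_comp_le (R := adjoint V) (T := adjoint B) hproj
  have hVV := norm_comp_comp_le (R := adjoint V) (T := V) (h.norm_regInv_le hα)
  rw [norm_adjoint] at hmain hVV
  rw [norm_adjoint, norm_adjoint] at hVB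
  rw [h.sandwich_sub_eq hα hX]
  refine norm_add₄_le.trans ?_
  linarith

theorem tendsto_sandwich {C' V X : ι → H →L[ℝ] H} {lam : ι → ℕ → ℝ} {e : ι → ℕ → H} {α : ι → ℝ}
    (h : ∀ i, IsEigenSystem (C' i) (lam i) (e i)) (hα : ∀ i, 0 < α i) (hα0 : Tendsto α l (𝓝 0))
    (hX : ∀ i, X i = C' i ∘L adjoint B + V i) (hC : Tendsto C' l (𝓝 C))
    (hV0 : Tendsto V l (𝓝 0)) (hV : Tendsto (fun i => ‖V i‖ ^ 2 * (√(α i))⁻¹) l (𝓝 0)) :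
    Tendsto (fun i => adjoint (X i) ∘L regInv (lam i) (e i) (numAbove (lam i) (α i)) ∘L X i) l
      (𝓝 (B ∘L C ∘L adjoint B)) := by
  refine tendsto_iff_norm_sub_tendsto_zero.2 (squeeze_zero (fun _ => norm_nonneg _)
    (fun i => (h i).norm_sandwich_sub_le (hα i) (hX i)) ?_)
  simpa using (((((tendsto_iff_norm_sub_tendsto_zero.1 hC).add hα0.sqrt).const_mul ‖B‖).mul_const
    ‖B‖).add ((hV0.norm.const_mul ‖B‖).const_mul 2)).add hV

-- With `R` and `R'` the regularized inverses of `C` and of `Q' = X^* R X`, and `r = R' ζ`, one has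
-- `⟪R X r, X r⟫ = ⟪Q' r, r⟫`. Bounding the four factors separately would cost an additional
-- `‖X‖ ^ 2 * (√α)⁻¹ * (√α')⁻¹`, which explodes.
theorem IsEigenSystem.norm_noise_sq_le (h : IsEigenSystem C lam e) (hα : 0 < α)
    (h' : IsEigenSystem (adjoint X ∘L regInv lam e (numAbove lam α) ∘L X) lam' e') (hα' : 0 < α') :
    ‖adjoint U ∘L regInv lam e (numAbove lam α) ∘L X ∘L regInv lam' e' (numAbove lam' α')‖ ^ 2
      ≤ ‖U‖ ^ 2 * ((√α)⁻¹ * (√α')⁻¹) := by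
  set R := regInv lam e (numAbove lam α)
  have hc : 0 ≤ ‖U‖ ^ 2 * ((√α)⁻¹ * (√α')⁻¹) := by positivity
  refine (Real.le_sqrt (norm_nonneg _) hc).1 <|
    ContinuousLinearMap.opNorm_le_bound _ (Real.sqrt_nonneg _) fun ζ =>
      le_of_sq_le_sq ?_ (by positivity)
  rw [mul_pow, Real.sq_sqrt hc]
  set r := regInv lam' e' (numAbove lam' α') ζ
  have henergy : inner ℝ (R (X r)) (X r) ≤ (√α')⁻¹ * ‖ζ‖ ^ 2 := by
    calc inner ℝ (R (X r)) (X r) = inner ℝ (spanProj e' (numAbove lam' α') ζ) r := by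
          rw [← h'.comp_regInv hα', ← ContinuousLinearMap.adjoint_inner_left]
          rfl
      _ ≤ ‖spanProj e' (numAbove lam' α') ζ‖ * ‖r‖ := real_inner_le_norm _ _
      _ ≤ (1 * ‖ζ‖) * ((√α')⁻¹ * ‖ζ‖) := by
          gcongr
          · exact ContinuousLinearMap.le_of_opNorm_le _ (norm_spanProj_le h'.orthonormal _) ζ
          · exact ContinuousLinearMap.le_of_opNorm_le _ (h'.norm_regInv_le hα') ζ
      _ = (√α')⁻¹ * ‖ζ‖ ^ 2 := by ring
  calc ‖adjoint U (R (X r))‖ ^ 2 ≤ (‖U‖ * ‖R (X r)‖) ^ 2 := by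
        gcongr
        exact ContinuousLinearMap.le_of_opNorm_le _ (norm_adjoint U).le _
    _ = ‖U‖ ^ 2 * ‖R (X r)‖ ^ 2 := mul_pow _ _ _
    _ ≤ ‖U‖ ^ 2 * ((√α)⁻¹ * ((√α')⁻¹ * ‖ζ‖ ^ 2)) := by
        gcongr
        exact (h.norm_regInv_apply_sq_le hα _).trans (by gcongr)
    _ = ‖U‖ ^ 2 * ((√α)⁻¹ * (√α')⁻¹) * ‖ζ‖ ^ 2 := by ring

theorem tendsto_twoStage {C' U V X : ι → H →L[ℝ] H} {lam lam' : ι → ℕ → ℝ}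
    {e e' : ι → ℕ → H} {α α' : ι → ℝ} (hA : IsHS A) (hQ : DenseRange (B ∘L C ∘L adjoint B))
    (hC : Tendsto C' l (𝓝 C)) (hX : ∀ i, X i = C' i ∘L adjoint B + V i)
    (hα : ∀ i, 0 < α i) (hα0 : Tendsto α l (𝓝 0)) (hα' : ∀ i, 0 < α' i) (hα'0 : Tendsto α' l (𝓝 0))
    (hV0 : Tendsto V l (𝓝 0)) (hV : Tendsto (fun i => ‖V i‖ ^ 2 * (√(α i))⁻¹) l (𝓝 0))
    (hU : Tendsto (fun i => ‖U i‖ ^ 2 * ((√(α i))⁻¹ * (√(α' i))⁻¹)) l (𝓝 0))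
    (h : ∀ i, IsEigenSystem (C' i) (lam i) (e i))
    (h' : ∀ i, IsEigenSystem
      (adjoint (X i) ∘L regInv (lam i) (e i) (numAbove (lam i) (α i)) ∘L X i) (lam' i) (e' i)) :
    Tendsto (fun i => (adjoint (X i ∘L adjoint A + U i) ∘L
      regInv (lam i) (e i) (numAbove (lam i) (α i)) ∘L X i) ∘L
        regInv (lam' i) (e' i) (numAbove (lam' i) (α' i))) l (𝓝 A) := by
  have hbias := hA.tendsto_comp_spanProj hQ (tendsto_sandwich h hα hα0 hX hC hV0 hV) h' hα' hα'0
  have hnoise := squeeze_zero (fun _ => sq_nonneg _)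
    (fun i => (h i).norm_noise_sq_le (U := U i) (hα i) (h' i) (hα' i)) hU
  have hnoise : Tendsto (fun i => adjoint (U i) ∘L regInv (lam i) (e i) (numAbove (lam i) (α i)) ∘L
      X i ∘L regInv (lam' i) (e' i) (numAbove (lam' i) (α' i))) l (𝓝 0) :=
    tendsto_zero_iff_norm_tendsto_zero.2 (by simpa using hnoise.sqrt)
  refine (add_zero A ▸ hbias.add hnoise).congr fun i => ?_
  rw [← (h' i).comp_regInv (hα' i), map_add, ContinuousLinearMap.adjoint_comp,
    ContinuousLinearMap.adjoint_adjoint]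
  rfl

end Regularization

section PopulationOperator

variable {H : Type*} [NormedAddCommGroup H] [InnerProductSpace ℝ H] [CompleteSpace H]
  {B C X : H →L[ℝ] H} {lam : ℕ → ℝ} {e : ℕ → H}

open ContinuousLinearMap (adjoint)

theorem IsEigenSystem.popQ_eq (h : IsEigenSystem C lam e) (hpos : ∀ j, 0 < lam j)
    (hX : X = C ∘L adjoint B) : popQ X lam e = B ∘L C ∘L adjoint B := by
  have hadj : adjoint X = B ∘L C := by
    rw [hX, ContinuousLinearMap.adjoint_comp, h.adjoint_eq, ContinuousLinearMap.adjoint_adjoint]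
  have hsum := (h.hasSum.mapL ((ContinuousLinearMap.compL ℝ H H H).flip (adjoint B))).mapL
    (ContinuousLinearMap.compL ℝ H H H B)
  refine HasSum.tsum_eq (hsum.congr_fun fun j => ?_)
  ext ζ
  have hinner : inner ℝ (e j) (C (adjoint B ζ)) = lam j * inner ℝ (e j) (adjoint B ζ) := by
    rw [← ContinuousLinearMap.adjoint_inner_left, h.adjoint_eq, h.apply_eq, real_inner_smul_left]
  have hcancel : (lam j)⁻¹ * (lam j * inner ℝ (e j) (adjoint B ζ) * lam j)
      = lam j * inner ℝ (e j) (adjoint B ζ) := by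
    field_simp [(hpos j).ne']
  rw [hadj, hX]
  simp [tens_apply, hinner, h.apply_eq, smul_smul, hcancel]

theorem IsEigenSystem.denseRange_of_popQ_injective (h : IsEigenSystem C lam e)
    (hpos : ∀ j, 0 < lam j) (hX : X = C ∘L adjoint B) (hker : ∀ ζ, popQ X lam e ζ = 0 → ζ = 0) :
    DenseRange (B ∘L C ∘L adjoint B) := by
  refine denseRange_of_adjoint_injective fun ζ hζ => hker ζ ?_
  simpa [h.popQ_eq hpos hX, ContinuousLinearMap.adjoint_comp, h.adjoint_eq] using hζ

end PopulationOperator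

section WeaklyCorrelated

open ProbabilityTheory

variable {Ω : Type*} [MeasurableSpace Ω] {P : Measure Ω}

theorem ae_tendsto_zero_of_integral_le {f : ℕ → Ω → ℝ} (hf : ∀ k, Integrable (f k) P)
    (hf0 : ∀ k ω, 0 ≤ f k ω) {b : ℕ → ℝ} (hb : Summable b) (hle : ∀ k, ∫ ω, f k ω ∂P ≤ b k) :
    ∀ᵐ ω ∂P, Tendsto (fun k => f k ω) atTop (𝓝 0) := by
  have hfin : ∫⁻ ω, ∑' k, ENNReal.ofReal (f k ω) ∂P ≠ ∞ := by
    rw [lintegral_tsum fun k => (hf k).aemeasurable.ennreal_ofReal]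
    refine ne_top_of_le_ne_top hb.tsum_ofReal_ne_top (ENNReal.tsum_le_tsum fun k => ?_)
    rw [← ofReal_integral_eq_lintegral_ofReal (hf k) (ae_of_all _ (hf0 k))]
    exact ENNReal.ofReal_le_ofReal (hle k)
  filter_upwards [ae_lt_top' (AEMeasurable.tsum
    fun k => (hf k).aemeasurable.ennreal_ofReal) hfin] with ω hω
  have hlim := (ENNReal.tendsto_toReal ENNReal.zero_ne_top).comp
    (ENNReal.tendsto_atTop_zero_of_tsum_ne_top hω.ne)
  simpa [Function.comp_def, ENNReal.toReal_ofReal (hf0 _ ω)] using hlim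

theorem tendsto_average_of_tendsto_sq {a : ℕ → ℝ} (ha : ∀ t, 0 ≤ a t) {p : ℝ}
    (h : Tendsto (fun k : ℕ => (∑ t ∈ Finset.range ((k + 1) ^ 2), a t) / ((k + 1) ^ 2 : ℕ))
      atTop (𝓝 p)) :
    Tendsto (fun n : ℕ => (∑ t ∈ Finset.range n, a t) / n) atTop (𝓝 p) := by
  refine tendsto_div_of_monotone_of_exists_subseq_tendsto_div _ _ (fun m n hmn =>
    Finset.sum_le_sum_of_subset_of_nonneg (Finset.range_mono hmn) fun t _ _ => ha t)
    fun b hb => ⟨fun k => (k + 1) ^ 2, ?_, ?_, h⟩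
  · have hratio : Tendsto (fun k : ℕ => (1 + 1 / ((k : ℝ) + 1)) ^ 2) atTop (𝓝 1) := by
      simpa using (tendsto_one_div_add_atTop_nhds_zero_nat (𝕜 := ℝ)).const_add 1 |>.pow 2
    filter_upwards [hratio.eventually_le_const hb] with k hk
    calc ((((k + 1 + 1) ^ 2 : ℕ)) : ℝ) = (1 + 1 / ((k : ℝ) + 1)) ^ 2 * ((k + 1) ^ 2 : ℕ) := by
          push_cast
          field_simp
      _ ≤ b * ((k + 1) ^ 2 : ℕ) := by gcongr
  · exact (tendsto_pow_atTop two_ne_zero).comp (tendsto_add_atTop_nat 1)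

variable [IsProbabilityMeasure P]

theorem variance_sum_range_le {Y : ℕ → Ω → ℝ} (hY : ∀ t, MemLp (Y t) 2 P) {c : ℕ → ℝ}
    (hc0 : ∀ k, 0 ≤ c k) (hc : Summable c) (hcov : ∀ s k, cov[Y s, Y (s + k); P] ≤ c k) (n : ℕ) :
    Var[∑ t ∈ Finset.range n, Y t; P] ≤ n * (2 * ∑' k, c k) := by
  induction n with
  | zero => simp
  | succ n ih =>
    have hcross : cov[∑ t ∈ Finset.range n, Y t, Y n; P] + Var[Y n; P] ≤ ∑' k, c k := by
      rw [covariance_sum_left' (fun t _ => hY t) (hY n), ← covariance_self (hY n).aemeasurable,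
        ← Finset.sum_range_succ fun t => cov[Y t, Y n; P]]
      calc ∑ t ∈ Finset.range (n + 1), cov[Y t, Y n; P]
          ≤ ∑ t ∈ Finset.range (n + 1), c (n - t) := Finset.sum_le_sum fun t ht => by
            simpa only [Nat.add_sub_of_le (Finset.mem_range_succ_iff.1 ht)] using hcov t (n - t)
        _ = ∑ k ∈ Finset.range (n + 1), c k := Finset.sum_range_reflect c (n + 1)
        _ ≤ ∑' k, c k := hc.sum_le_tsum _ fun k _ => hc0 k
    rw [Finset.sum_range_succ, variance_add (memLp_finsetSum' _ fun t _ => hY t) (hY n)]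
    push_cast
    linarith [variance_nonneg (Y n) P]

theorem ae_tendsto_average_of_variance_le {Y : ℕ → Ω → ℝ} (hY0 : ∀ t ω, 0 ≤ Y t ω)
    (hY : ∀ t, MemLp (Y t) 2 P) {p : ℝ} (hp : ∀ t, ∫ ω, Y t ω ∂P = p) {C : ℝ}
    (hvar : ∀ n : ℕ, Var[∑ t ∈ Finset.range n, Y t; P] ≤ n * C) :
    ∀ᵐ ω ∂P, Tendsto (fun n : ℕ => (∑ t ∈ Finset.range n, Y t ω) / n) atTop (𝓝 p) := by
  set S : ℕ → Ω → ℝ := fun n => ∑ t ∈ Finset.range n, Y t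
  have hS : ∀ n, MemLp (S n) 2 P := fun n => memLp_finsetSum' _ fun t _ => hY t
  have hmean : ∀ n : ℕ, ∫ ω, S n ω ∂P = n * p := fun n => by
    simp only [S, Finset.sum_apply]
    rw [integral_finsetSum _ fun t _ => (hY t).integrable one_le_two]
    simp [hp]
  have hsummable : Summable fun k : ℕ => 1 / ((k + 1 : ℕ) : ℝ) ^ 2 * C :=
    ((summable_nat_add_iff 1).2 (Real.summable_one_div_nat_pow.2 one_lt_two)).mul_right C
  have hlim := ae_tendsto_zero_of_integral_le (P := P)
    (f := fun k ω => ((S ((k + 1) ^ 2) ω - ((k + 1) ^ 2 : ℕ) * p) / ((k + 1) ^ 2 : ℕ)) ^ 2)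
    (fun k => by
      simp only [div_pow]
      exact ((hS _).sub (memLp_const _)).integrable_sq.div_const _)
    (fun _ _ => sq_nonneg _) hsummable fun k => by
      have h := hvar ((k + 1) ^ 2)
      rw [variance_eq_integral (hS _).aemeasurable, hmean] at h
      simp only [div_pow, integral_div]
      rw [div_le_iff₀ (by positivity)]
      refine h.trans_eq ?_
      push_cast
      field_simp
  filter_upwards [hlim] with ω hω
  refine tendsto_average_of_tendsto_sq (fun t => hY0 t ω) ?_
  have habs := hω.sqrt
  simp only [Real.sqrt_sq_eq_abs, Real.sqrt_zero] at habs
  have hsub := ((tendsto_zero_iff_abs_tendsto_zero _).2 habs).add_const p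
  rw [zero_add] at hsub
  refine hsub.congr fun k => ?_
  have : (((k + 1) ^ 2 : ℕ) : ℝ) ≠ 0 := by positivity
  simp only [S, Finset.sum_apply]
  field_simp
  ring

end WeaklyCorrelated

section StrongLaw

variable {Ω E : Type*} [MeasurableSpace Ω] [MeasurableSpace E] {P : Measure Ω} {w : ℕ → Ω → E}
  {Q : Measure E} {G : Type*} [NormedAddCommGroup G] [NormedSpace ℝ G]

/-- The strong law of large numbers for the function `F` along the sequence `w`: almost surely, the
averages of `F (w t)` converge to the integral of `F` with respect to the limit law `Q`. -/
def ObeysSLLN (P : Measure Ω) (w : ℕ → Ω → E) (Q : Measure E) (F : E → G) : Prop :=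
  ∀ᵐ ω ∂P, Tendsto (fun n : ℕ => (n : ℝ)⁻¹ • ∑ t ∈ Finset.range n, F (w t ω)) atTop
    (𝓝 (∫ e, F e ∂Q))

theorem ObeysSLLN.add {F F' : E → G} (hF : ObeysSLLN P w Q F) (hF' : ObeysSLLN P w Q F')
    (hFi : Integrable F Q) (hFi' : Integrable F' Q) : ObeysSLLN P w Q (F + F') := by
  filter_upwards [hF, hF'] with ω h h'
  simp only [Pi.add_apply, Finset.sum_add_distrib, smul_add]
  rw [integral_add hFi hFi']
  exact h.add h'

theorem ObeysSLLN.smul_const [CompleteSpace G] {f : E → ℝ} (hf : ObeysSLLN P w Q f) (c : G) :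
    ObeysSLLN P w Q fun e => f e • c := by
  filter_upwards [hf] with ω h
  rw [integral_smul_const]
  simpa only [smul_eq_mul, ← Finset.sum_smul, ← smul_smul] using h.smul_const c

theorem obeysSLLN_const [IsProbabilityMeasure Q] [CompleteSpace G] (c : G) :
    ObeysSLLN P w Q fun _ => c := by
  refine ae_of_all _ fun ω => tendsto_const_nhds.congr' ?_
  filter_upwards [eventually_ne_atTop 0] with n hn
  have : (n : ℝ) ≠ 0 := Nat.cast_ne_zero.2 hn
  simp [← Nat.cast_smul_eq_nsmul ℝ, smul_smul, this]

theorem ObeysSLLN.of_approx {F : E → G} (hw : ∀ t, MeasurePreserving (w t) P Q)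
    (hFi : Integrable F Q)
    (happrox : ∀ ε > 0, ∃ (φ : E → G) (ψ : E → ℝ), ObeysSLLN P w Q φ ∧ ObeysSLLN P w Q ψ ∧
      Integrable φ Q ∧ Integrable ψ Q ∧ (∀ᵐ e ∂Q, ‖F e - φ e‖ ≤ ψ e) ∧ ∫ e, ψ e ∂Q ≤ ε) :
    ObeysSLLN P w Q F := by
  choose! φ ψ hφ hψ hφi hψi hle hint using
    fun j : ℕ => happrox (1 / ((j : ℝ) + 1)) (by positivity)
  filter_upwards [ae_all_iff.2 hφ, ae_all_iff.2 hψ,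
    ae_all_iff.2 fun j => ae_all_iff.2 fun t => (hw t).quasiMeasurePreserving.ae (hle j)]
    with ω hφω hψω hleω
  refine Metric.tendsto_atTop'.2 fun ε hε => ?_
  obtain ⟨j, hj⟩ := exists_nat_one_div_lt (show 0 < ε / 3 by positivity)
  have hψlim := (hψω j).eventually_lt_const ((hint j).trans_lt hj)
  have hφlim := Metric.tendsto_nhds.1 (hφω j) (ε / 3) (by positivity)
  have hmean : ‖∫ e, φ j e ∂Q - ∫ e, F e ∂Q‖ ≤ ε / 3 := by
    rw [norm_sub_rev, ← integral_sub hFi (hφi j)]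
    exact (norm_integral_le_of_norm_le (hψi j) (hle j)).trans ((hint j).trans hj.le)
  obtain ⟨N, hN⟩ := eventually_atTop.1 (hψlim.and hφlim)
  refine ⟨N, fun n hn => ?_⟩
  obtain ⟨hψn, hφn⟩ := hN n hn.le
  have havg : ‖(n : ℝ)⁻¹ • ∑ t ∈ Finset.range n, F (w t ω)
      - (n : ℝ)⁻¹ • ∑ t ∈ Finset.range n, φ j (w t ω)‖ < ε / 3 := by
    rw [← smul_sub, ← Finset.sum_sub_distrib, norm_smul, norm_inv, RCLike.norm_natCast]
    refine lt_of_le_of_lt ?_ hψn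
    rw [smul_eq_mul]
    gcongr
    exact norm_sum_le_of_le _ fun t _ => hleω j t
  rw [dist_eq_norm] at hφn ⊢
  linarith [norm_sub_le_norm_sub_add_norm_sub ((n : ℝ)⁻¹ • ∑ t ∈ Finset.range n, F (w t ω))
    ((n : ℝ)⁻¹ • ∑ t ∈ Finset.range n, φ j (w t ω)) (∫ e, F e ∂Q),
    norm_sub_le_norm_sub_add_norm_sub ((n : ℝ)⁻¹ • ∑ t ∈ Finset.range n, φ j (w t ω))
    (∫ e, φ j e ∂Q) (∫ e, F e ∂Q)]

variable [CompleteSpace G] [IsProbabilityMeasure Q]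

theorem obeysSLLN_simpleFunc
    (hind : ∀ S, MeasurableSet S → ObeysSLLN P w Q (S.indicator fun _ => (1 : ℝ)))
    (φ : SimpleFunc E G) : ObeysSLLN P w Q φ := by
  induction φ using SimpleFunc.induction with
  | @const c S hS =>
    convert (hind S hS).smul_const c using 1
    ext e
    by_cases he : e ∈ S <;> simp [he]
  | add _ hf hg =>
    exact hf.add hg (SimpleFunc.integrable_of_isFiniteMeasure _)
      (SimpleFunc.integrable_of_isFiniteMeasure _)

theorem obeysSLLN_of_norm_le (hw : ∀ t, MeasurePreserving (w t) P Q)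
    (hind : ∀ S, MeasurableSet S → ObeysSLLN P w Q (S.indicator fun _ => (1 : ℝ)))
    {F : E → G} (hF : StronglyMeasurable F) {M : ℝ} (hM : ∀ᵐ e ∂Q, ‖F e‖ ≤ M) :
    ObeysSLLN P w Q F := by
  have hM0 : 0 ≤ M := (norm_nonneg _).trans hM.exists.choose_spec
  refine .of_approx hw (.of_bound hF.aestronglyMeasurable M hM) fun ε hε => ?_
  set φ := hF.approxBounded M
  set S : ℕ → Set E := fun k => {e | ε / 2 ≤ ‖φ k e - F e‖}
  have hS : ∀ k, MeasurableSet (S k) := fun k =>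
    measurableSet_le measurable_const ((φ k).stronglyMeasurable.sub hF).norm.measurable
  have hSlim : Tendsto (fun k => Q.real (S k)) atTop (𝓝 0) := by
    have h := tendstoInMeasure_of_tendsto_ae (μ := Q)
      (fun k => (φ k).stronglyMeasurable.aestronglyMeasurable) (hF.tendsto_approxBounded_ae hM)
    exact (ENNReal.tendsto_toReal ENNReal.zero_ne_top).comp
      (tendstoInMeasure_iff_norm.1 h (ε / 2) (by positivity))
  obtain ⟨k, hk⟩ := ((hSlim.mul_const (2 * M)).eventually_lt_const
    (show 0 * (2 * M) < ε / 2 by simpa using hε)).exists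
  have hSi : Integrable ((S k).indicator fun _ => (1 : ℝ)) Q :=
    (integrable_const 1).indicator (hS k)
  refine ⟨φ k, (fun _ => ε / 2) + fun e => (S k).indicator (fun _ => (1 : ℝ)) e • (2 * M),
    obeysSLLN_simpleFunc hind _, (obeysSLLN_const _).add ((hind _ (hS k)).smul_const _)
      (integrable_const _) (hSi.smul_const _), SimpleFunc.integrable_of_isFiniteMeasure _,
    (integrable_const _).add (hSi.smul_const _), ?_, ?_⟩
  · filter_upwards [hM] with e he
    rw [norm_sub_rev, Pi.add_apply]
    by_cases heS : e ∈ S k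
    · rw [Set.indicator_of_mem heS, one_smul]
      linarith [norm_sub_le (φ k e) (F e), hF.norm_approxBounded_le hM0 k e]
    · rw [Set.indicator_of_notMem heS, zero_smul, add_zero]
      exact (not_le.1 heS).le
  · simp only [Pi.add_apply]
    rw [integral_add (integrable_const _) (hSi.smul_const _), integral_smul_const,
      show ∫ e, (S k).indicator (fun _ => (1 : ℝ)) e ∂Q = Q.real (S k) from
        integral_indicator_one (hS k)]
    simp only [integral_const, probReal_univ, smul_eq_mul]
    linarith

end StrongLaw

section Mixing

open ProbabilityTheory

variable {Ω E : Type*} [MeasurableSpace Ω] [MeasurableSpace E] {P : Measure Ω} {w : ℕ → Ω → E}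

theorem IsStationary.map_eq (hst : IsStationary P w) (hw : ∀ t, Measurable (w t)) (t : ℕ) :
    P.map (w t) = P.map (w 0) := by
  induction t with
  | zero => rfl
  | succ t ih =>
    have h := congrArg (Measure.map fun q : ℕ → E => q t) hst
    rw [Measure.map_map (measurable_pi_apply t) (measurable_pi_lambda _ fun s => hw (s + 1)),
      Measure.map_map (measurable_pi_apply t) (measurable_pi_lambda _ fun s => hw s)] at h
    exact h.trans ih

theorem IsStationary.comp {E' : Type*} [MeasurableSpace E'] (hst : IsStationary P w)
    (hw : ∀ t, Measurable (w t)) {f : E → E'} (hf : Measurable f) :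
    IsStationary P fun t ω => f (w t ω) := by
  have h := congrArg (Measure.map fun (q : ℕ → E) t => f (q t)) hst
  have hf' : Measurable fun (q : ℕ → E) t => f (q t) :=
    measurable_pi_lambda _ fun t => hf.comp (measurable_pi_apply t)
  rwa [Measure.map_map hf' (measurable_pi_lambda _ fun s => hw (s + 1)),
    Measure.map_map hf' (measurable_pi_lambda _ fun s => hw s)] at h

theorem IsGeomStronglyMixing.comp {E' : Type*} [MeasurableSpace E']
    (hmix : IsGeomStronglyMixing P w) {f : E → E'} (hf : Measurable f) :
    IsGeomStronglyMixing P fun t ω => f (w t ω) := by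
  have hle (I : Set ℕ) : sigmaOn (fun t ω => f (w t ω)) I ≤ sigmaOn w I :=
    iSup₂_mono fun t _ => MeasurableSpace.comap_comp (f := f) (g := w t) ▸
      MeasurableSpace.comap_mono hf.comap_le
  obtain ⟨C, ρ, hρ0, hρ1, hC⟩ := hmix
  exact ⟨C, ρ, hρ0, hρ1, fun k n S S' hS hS' => hC k n S S' (hle _ _ hS) (hle _ _ hS')⟩

theorem measurableSet_sigmaOn {Ω : Type*} {w : ℕ → Ω → E} {I : Set ℕ} {t : ℕ} (ht : t ∈ I)
    {S : Set E} (hS : MeasurableSet S) : MeasurableSet[sigmaOn w I] (w t ⁻¹' S) :=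
  le_iSup₂ (f := fun t (_ : t ∈ I) => MeasurableSpace.comap (w t) inferInstance) t ht _
    ⟨S, hS, rfl⟩

theorem covariance_indicator_one [IsProbabilityMeasure P] {S S' : Set Ω} (hS : MeasurableSet S)
    (hS' : MeasurableSet S') :
    cov[S.indicator 1, S'.indicator 1; P] = P.real (S ∩ S') - P.real S * P.real S' := by
  have hmem {S : Set Ω} (hS : MeasurableSet S) : MemLp (S.indicator (1 : Ω → ℝ)) 2 P :=
    memLp_indicator_const 2 hS 1 (.inr (measure_ne_top _ _))
  rw [covariance_eq_sub (hmem hS) (hmem hS'), integral_indicator_one hS,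
    integral_indicator_one hS', ← integral_indicator_one (hS.inter hS'), Set.inter_indicator_one]

variable [IsProbabilityMeasure P]

theorem obeysSLLN_indicator (hw : ∀ t, Measurable (w t)) (hst : IsStationary P w)
    (hmix : IsGeomStronglyMixing P w) {S : Set E} (hS : MeasurableSet S) :
    ObeysSLLN P w (P.map (w 0)) (S.indicator fun _ => (1 : ℝ)) := by
  obtain ⟨C, ρ, hρ0, hρ1, hC⟩ := hmix
  set Y : ℕ → Ω → ℝ := fun t => (w t ⁻¹' S).indicator 1
  have hcov (t k : ℕ) : cov[Y t, Y (t + k); P] ≤ |C| * ρ ^ k := by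
    rw [covariance_indicator_one (hw t hS) (hw _ hS)]
    refine (le_abs_self _).trans ((hC k t _ _ (measurableSet_sigmaOn Set.self_mem_Iic hS)
      (measurableSet_sigmaOn Set.self_mem_Ici hS)).trans ?_)
    gcongr
    exact le_abs_self C
  have hY (t : ℕ) : MemLp (Y t) 2 P :=
    memLp_indicator_const 2 (hw t hS) 1 (.inr (measure_ne_top _ _))
  have hmean (t : ℕ) : ∫ ω, Y t ω ∂P = ∫ e, S.indicator (fun _ => (1 : ℝ)) e ∂(P.map (w 0)) := by
    rw [integral_indicator_one (hw t hS), ← map_measureReal_apply (hw t) hS, hst.map_eq hw t]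
    exact (integral_indicator_one hS).symm
  filter_upwards [ae_tendsto_average_of_variance_le
    (fun t ω => Set.indicator_nonneg (fun _ _ => zero_le_one) ω) hY hmean
    (variance_sum_range_le hY (fun k => by positivity)
      ((summable_geometric_of_lt_one hρ0.le hρ1).mul_left |C|) hcov)] with ω hω
  simp only [div_eq_inv_mul] at hω
  exact hω

theorem IsGeomStronglyMixing.obeysSLLN {G : Type*} [NormedAddCommGroup G] [NormedSpace ℝ G]
    [CompleteSpace G] (hmix : IsGeomStronglyMixing P w) (hst : IsStationary P w)
    (hw : ∀ t, Measurable (w t)) {F : E → G} (hF : StronglyMeasurable F) {M : ℝ}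
    (hM : ∀ᵐ ω ∂P, ‖F (w 0 ω)‖ ≤ M) : ObeysSLLN P w (P.map (w 0)) F :=
  have := Measure.isProbabilityMeasure_map (μ := P) (hw 0).aemeasurable
  obeysSLLN_of_norm_le (fun t => ⟨hw t, hst.map_eq hw t⟩)
    (fun _ hS => obeysSLLN_indicator hw hst hmix hS) hF
    ((ae_map_iff (hw 0).aemeasurable (hF.norm.measurable measurableSet_Iic)).2 hM)

end Mixing

section MartingaleMoments

variable {Ω E : Type*} {m0 : MeasurableSpace Ω} {P : Measure Ω} {ℱ : Filtration ℕ m0}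
  [NormedAddCommGroup E] {M : ℕ → Ω → E} {c : ℝ}

theorem ae_norm_le_of_norm_sub_le (h0 : M 0 =ᵐ[P] 0)
    (hc : ∀ n, ∀ᵐ ω ∂P, ‖M (n + 1) ω - M n ω‖ ≤ c) (n : ℕ) : ∀ᵐ ω ∂P, ‖M n ω‖ ≤ n * c := by
  induction n with
  | zero => filter_upwards [h0] with ω hω using by simp [hω]
  | succ n ih =>
    filter_upwards [ih, hc n] with ω hω hcω
    push_cast
    linarith [norm_le_norm_add_norm_sub' (M (n + 1) ω) (M n ω)]

variable [InnerProductSpace ℝ E]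

theorem norm_add_pow_four_le (a d : E) :
    ‖a + d‖ ^ 4 ≤ ‖a‖ ^ 4 + 4 * inner ℝ (‖a‖ ^ 2 • a) d + 8 * ‖d‖ ^ 2 * ‖a‖ ^ 2
      + 3 * ‖d‖ ^ 4 := by
  have hb : inner ℝ a d ^ 2 ≤ ‖a‖ ^ 2 * ‖d‖ ^ 2 := by
    rw [← mul_pow, ← sq_abs]
    exact pow_le_pow_left₀ (abs_nonneg _) (abs_real_inner_le_norm a d) 2
  rw [real_inner_smul_left]
  calc ‖a + d‖ ^ 4 = (‖a‖ ^ 2 + 2 * inner ℝ a d + ‖d‖ ^ 2) ^ 2 := by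
        rw [← norm_add_sq_real]
        ring
    _ ≤ _ := by nlinarith [sq_nonneg (inner ℝ a d - ‖d‖ ^ 2)]

theorem integrable_inner_of_norm_le [IsFiniteMeasure P] {f g : Ω → E} {C : ℝ}
    (hf : AEStronglyMeasurable f P) (hg : AEStronglyMeasurable g P)
    (hfC : ∀ᵐ ω ∂P, ‖f ω‖ ≤ C) (hgc : ∀ᵐ ω ∂P, ‖g ω‖ ≤ c) :
    Integrable (fun ω => inner ℝ (f ω) (g ω)) P :=
  .of_bound (hf.inner hg) (C * c) <| by
    filter_upwards [hfC, hgc] with ω h h'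
    exact (norm_inner_le_norm _ _).trans
      (mul_le_mul h h' (norm_nonneg _) ((norm_nonneg _).trans h))

variable [CompleteSpace E]

theorem integral_inner_martingale_increment [IsFiniteMeasure P] (hM : Martingale M ℱ P) {n : ℕ}
    {f : Ω → E} (hf : StronglyMeasurable[ℱ n] f)
    (hfi : Integrable (fun ω => inner ℝ (f ω) ((M (n + 1) - M n) ω)) P) :
    ∫ ω, inner ℝ (f ω) ((M (n + 1) - M n) ω) ∂P = 0 := by
  have hcond : P[M (n + 1) - M n | ℱ n] =ᵐ[P] 0 := by
    filter_upwards [condExp_sub (hM.integrable (n + 1)) (hM.integrable n) (ℱ n),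
      hM.condExp_ae_eq n.le_succ, hM.condExp_ae_eq le_rfl] with ω h h1 h2
    rw [h, Pi.sub_apply, h1, h2, sub_self, Pi.zero_apply]
  rw [← integral_condExp (ℱ.le n)]
  refine integral_eq_zero_of_ae ?_
  filter_upwards [condExp_bilin_of_stronglyMeasurable_left (innerSL ℝ) hf hfi
    ((hM.integrable _).sub (hM.integrable n)), hcond] with ω h1 h2
  refine h1.trans ?_
  rw [h2]
  simp

theorem submartingale_norm_pow [IsFiniteMeasure P] (hM : Martingale M ℱ P) (p : ℕ)
    (hi : ∀ n, Integrable (fun ω => ‖M n ω‖ ^ p) P) :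
    Submartingale (fun n ω => ‖M n ω‖ ^ p) ℱ P := by
  refine submartingale_nat (fun n => (hM.stronglyMeasurable n).norm.pow p) hi fun n => ?_
  have hconvex : ConvexOn ℝ Set.univ fun a : E => ‖a‖ ^ p :=
    convexOn_univ_norm.pow (fun _ _ => norm_nonneg _) p
  filter_upwards [hM.condExp_ae_eq n.le_succ, hconvex.map_condExp_le_univ (ℱ.le n)
    (continuous_norm.pow p).lowerSemicontinuous (hM.integrable (n + 1)) (hi (n + 1))] with ω h h'
  simp only [Function.comp_apply, h] at h'
  exact h'

variable [IsProbabilityMeasure P] (hM : Martingale M ℱ P) (h0 : M 0 =ᵐ[P] 0)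
  (hc : ∀ n, ∀ᵐ ω ∂P, ‖M (n + 1) ω - M n ω‖ ≤ c)

include hM h0 hc

theorem integrable_norm_pow (p n : ℕ) : Integrable (fun ω => ‖M n ω‖ ^ p) P :=
  .of_bound ((hM.integrable n).aestronglyMeasurable.norm.pow p) ((n * c) ^ p) <| by
    filter_upwards [ae_norm_le_of_norm_sub_le h0 hc n] with ω hω
    rw [norm_pow, norm_norm]
    exact pow_le_pow_left₀ (norm_nonneg _) hω p

theorem integral_inner_norm_pow_smul_increment (p n : ℕ) :
    Integrable (fun ω => inner ℝ (‖M n ω‖ ^ p • M n ω) ((M (n + 1) - M n) ω)) P ∧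
      ∫ ω, inner ℝ (‖M n ω‖ ^ p • M n ω) ((M (n + 1) - M n) ω) ∂P = 0 := by
  have hMm := hM.stronglyMeasurable n
  have hf := (hMm.norm.pow p).smul hMm
  have hi := integrable_inner_of_norm_le (C := (n * c) ^ p * (n * c))
    (hf.mono (ℱ.le n)).aestronglyMeasurable
    ((hM.integrable (n + 1)).sub (hM.integrable n)).aestronglyMeasurable
    (by
      filter_upwards [ae_norm_le_of_norm_sub_le h0 hc n] with ω hω
      simp only [Pi.smul_apply', Pi.pow_apply, norm_smul, norm_pow, norm_norm]
      have := (norm_nonneg _).trans hω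
      gcongr) (hc n)
  exact ⟨hi, integral_inner_martingale_increment hM hf hi⟩

theorem integral_norm_sq_martingale_le (n : ℕ) : ∫ ω, ‖M n ω‖ ^ 2 ∂P ≤ n * c ^ 2 := by
  induction n with
  | zero =>
    rw [integral_eq_zero_of_ae (by filter_upwards [h0] with ω hω using by simp [hω])]
    simp
  | succ n ih =>
    obtain ⟨hi, hcross⟩ := integral_inner_norm_pow_smul_increment hM h0 hc 0 n
    have hsq := integrable_norm_pow hM h0 hc 2
    have hsum : Integrable (fun ω => ‖M n ω‖ ^ 2
        + 2 * inner ℝ (‖M n ω‖ ^ 0 • M n ω) ((M (n + 1) - M n) ω)) P :=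
      (hsq n).add (hi.const_mul 2)
    calc ∫ ω, ‖M (n + 1) ω‖ ^ 2 ∂P
        ≤ ∫ ω, (‖M n ω‖ ^ 2 + 2 * inner ℝ (‖M n ω‖ ^ 0 • M n ω) ((M (n + 1) - M n) ω)
            + c ^ 2) ∂P := by
          refine integral_mono_ae (hsq _) (hsum.add (integrable_const _)) ?_
          filter_upwards [hc n] with ω hω
          have hexp := norm_add_sq_real (M n ω) (M (n + 1) ω - M n ω)
          rw [add_sub_cancel] at hexp
          simp only [hexp, pow_zero, one_smul, Pi.sub_apply]
          gcongr
      _ = ∫ ω, ‖M n ω‖ ^ 2 ∂P + c ^ 2 := by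
          rw [integral_add hsum (integrable_const _), integral_add (hsq n) (hi.const_mul 2),
            integral_const_mul, hcross]
          simp
      _ ≤ (n + 1 : ℕ) * c ^ 2 := by
          push_cast
          linarith

theorem integral_norm_pow_four_martingale_le (n : ℕ) :
    ∫ ω, ‖M n ω‖ ^ 4 ∂P ≤ 8 * c ^ 4 * n ^ 2 := by
  induction n with
  | zero =>
    rw [integral_eq_zero_of_ae (by filter_upwards [h0] with ω hω using by simp [hω])]
    simp
  | succ n ih =>
    obtain ⟨hi, hcross⟩ := integral_inner_norm_pow_smul_increment hM h0 hc 2 n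
    have hpow := integrable_norm_pow hM h0 hc
    have hsum : Integrable (fun ω => ‖M n ω‖ ^ 4
        + 4 * inner ℝ (‖M n ω‖ ^ 2 • M n ω) ((M (n + 1) - M n) ω)) P :=
      (hpow 4 n).add (hi.const_mul 4)
    have hsum' : Integrable (fun ω => ‖M n ω‖ ^ 4
        + 4 * inner ℝ (‖M n ω‖ ^ 2 • M n ω) ((M (n + 1) - M n) ω)
        + 8 * c ^ 2 * ‖M n ω‖ ^ 2) P :=
      hsum.add ((hpow 2 n).const_mul (8 * c ^ 2))
    calc ∫ ω, ‖M (n + 1) ω‖ ^ 4 ∂P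
        ≤ ∫ ω, (‖M n ω‖ ^ 4 + 4 * inner ℝ (‖M n ω‖ ^ 2 • M n ω) ((M (n + 1) - M n) ω)
            + 8 * c ^ 2 * ‖M n ω‖ ^ 2 + 3 * c ^ 4) ∂P := by
          refine integral_mono_ae (hpow 4 _) (hsum'.add (integrable_const _)) ?_
          filter_upwards [hc n] with ω hω
          have hexp := norm_add_pow_four_le (M n ω) (M (n + 1) ω - M n ω)
          rw [add_sub_cancel] at hexp
          refine hexp.trans ?_
          rw [Pi.sub_apply]
          gcongr
      _ = ∫ ω, ‖M n ω‖ ^ 4 ∂P + 8 * c ^ 2 * ∫ ω, ‖M n ω‖ ^ 2 ∂P + 3 * c ^ 4 := by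
          rw [integral_add hsum' (integrable_const _),
            integral_add hsum ((hpow 2 n).const_mul _), integral_add (hpow 4 n) (hi.const_mul 4),
            integral_const_mul, integral_const_mul, hcross]
          simp
      _ ≤ 8 * c ^ 4 * n ^ 2 + 8 * c ^ 2 * (n * c ^ 2) + 3 * c ^ 4 := by
          gcongr
          exact integral_norm_sq_martingale_le hM h0 hc n
      _ ≤ 8 * c ^ 4 * ((n + 1 : ℕ) : ℝ) ^ 2 := by
          push_cast
          nlinarith [pow_nonneg (sq_nonneg c) 2]

end MartingaleMoments

section DyadicBound

variable {Ω : Type*} {m0 : MeasurableSpace Ω} {P : Measure Ω} {ℱ : Filtration ℕ m0}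

theorem eventually_le_mul_log_of_dyadic {a : ℕ → ℝ}
    (h : ∀ᶠ k : ℕ in atTop, ∀ n ≤ 2 ^ (k + 1), a n ≤ 2 ^ (k + 1) * (k + 1)) :
    ∀ᶠ n : ℕ in atTop, a n ≤ 8 * (n * Real.log n) := by
  obtain ⟨N, hN⟩ := eventually_atTop.1 h
  filter_upwards [eventually_ge_atTop (2 ^ (N + 1))] with n hn
  set k := Nat.log 2 n
  have hNk : N + 1 ≤ k := Nat.le_log_of_pow_le one_lt_two hn
  have hn0 : n ≠ 0 := (Nat.two_pow_pos _).trans_le hn |>.ne'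
  have hpow : (2 : ℝ) ^ k ≤ n := mod_cast Nat.pow_log_le_self 2 hn0
  have hlog : (k : ℝ) * Real.log 2 ≤ Real.log n := by
    rw [← Real.log_pow]
    exact Real.log_le_log (by positivity) hpow
  have hk : (k : ℝ) + 1 ≤ 4 * Real.log n := by
    have : (1 : ℝ) ≤ k := mod_cast (Nat.le_add_left 1 N).trans hNk
    nlinarith [Real.log_two_gt_d9]
  calc a n ≤ 2 ^ (k + 1) * (k + 1) :=
        hN k (N.le_succ.trans hNk) n (Nat.lt_pow_succ_log_self one_lt_two n).le
    _ = 2 * 2 ^ k * (k + 1) := by ring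
    _ ≤ 2 * n * (4 * Real.log n) := by gcongr
    _ = 8 * (n * Real.log n) := by ring

theorem measure_exists_ge_le_of_submartingale [IsFiniteMeasure P] {f : ℕ → Ω → ℝ}
    (hf : Submartingale f ℱ P) (hf0 : 0 ≤ f) {ε : ℝ} (hε : 0 < ε) (n : ℕ) :
    P {ω | ∃ k ≤ n, ε ≤ f k ω} ≤ ENNReal.ofReal ((∫ ω, f n ω ∂P) / ε) := by
  lift ε to NNReal using hε.le
  have h := (maximal_ineq hf hf0 (ε := ε) n).trans (ENNReal.ofReal_le_ofReal
    (setIntegral_le_integral (hf.integrable n) (ae_of_all _ (hf0 n))))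
  rw [mul_comm, ← ENNReal.le_div_iff_mul_le (.inl (by simpa using hε.ne'))
    (.inl ENNReal.coe_ne_top), ← ENNReal.ofReal_coe_nnreal, ← ENNReal.ofReal_div_of_pos hε] at h
  simpa [Finset.le_sup'_iff, Nat.lt_succ_iff] using h

theorem ae_eventually_le_mul_log_of_submartingale [IsFiniteMeasure P] {D : ℕ → Ω → ℝ} {K : ℝ}
    (hD : Submartingale (fun n ω => D n ω ^ 2) ℱ P)
    (hK : ∀ n : ℕ, ∫ ω, D n ω ^ 2 ∂P ≤ K * n ^ 2) :
    ∀ᵐ ω ∂P, ∀ᶠ n : ℕ in atTop, D n ω ≤ 8 * (n * Real.log n) := by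
  have hsummable : Summable fun k : ℕ => K * (1 / ((k + 1 : ℕ) : ℝ) ^ 2) :=
    ((summable_nat_add_iff 1).2 (Real.summable_one_div_nat_pow.2 one_lt_two)).mul_left K
  have hBC : ∑' k : ℕ, P {ω | ∃ n ≤ 2 ^ (k + 1), ((2 : ℝ) ^ (k + 1) * (k + 1)) ^ 2 ≤ D n ω ^ 2}
      ≠ ∞ := by
    refine ne_top_of_le_ne_top hsummable.tsum_ofReal_ne_top (ENNReal.tsum_le_tsum fun k => ?_)
    refine (measure_exists_ge_le_of_submartingale hD (fun _ _ => sq_nonneg _) (by positivity)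
      _).trans (ENNReal.ofReal_le_ofReal ?_)
    rw [div_le_iff₀ (by positivity)]
    refine (hK _).trans_eq ?_
    push_cast
    field_simp
  filter_upwards [ae_eventually_notMem hBC] with ω hω
  refine eventually_le_mul_log_of_dyadic (hω.mono fun k hk n hn => ?_)
  by_contra! hlt
  exact hk ⟨n, hn, by gcongr⟩

theorem ae_norm_sq_martingale_isBigO [IsProbabilityMeasure P] {E : Type*} [NormedAddCommGroup E]
    [InnerProductSpace ℝ E] [CompleteSpace E] {M : ℕ → Ω → E} {c : ℝ} (hM : Martingale M ℱ P)
    (h0 : M 0 =ᵐ[P] 0) (hc : ∀ n, ∀ᵐ ω ∂P, ‖M (n + 1) ω - M n ω‖ ≤ c) :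
    ∀ᵐ ω ∂P, (fun n => ‖M n ω‖ ^ 2) =O[atTop] fun n : ℕ => n * Real.log n := by
  filter_upwards [ae_eventually_le_mul_log_of_submartingale (ℱ := ℱ) (K := 8 * c ^ 4)
    (D := fun n ω => ‖M n ω‖ ^ 2)
    (by simpa only [← pow_mul] using submartingale_norm_pow hM 4 (integrable_norm_pow hM h0 hc 4))
    (fun n => by simpa only [← pow_mul] using integral_norm_pow_four_martingale_le hM h0 hc n)]
    with ω hω
  refine .of_bound 8 (hω.mono fun n hn => ?_)
  rw [Real.norm_of_nonneg (sq_nonneg _)]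
  exact hn.trans (mul_le_mul_of_nonneg_left (le_abs_self _) (by norm_num))

end DyadicBound

section MartingaleTransform

variable {Ω E F G : Type*} {m0 : MeasurableSpace Ω} {P : Measure Ω} {ℱ : Filtration ℕ m0}
  [NormedAddCommGroup E] [NormedSpace ℝ E] [NormedAddCommGroup F] [NormedSpace ℝ F]
  [CompleteSpace F] [NormedAddCommGroup G] [NormedSpace ℝ G] [CompleteSpace G]

theorem martingale_sum_bilin [IsFiniteMeasure P] (L : F →L[ℝ] E →L[ℝ] G) {u : ℕ → Ω → F}
    {z : ℕ → Ω → E} (hu : ∀ t, StronglyMeasurable[ℱ (t + 1)] (u t))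
    (hz : ∀ t, StronglyMeasurable[ℱ t] (z t)) (hui : ∀ t, Integrable (u t) P)
    (huz : ∀ t, Integrable (fun ω => L (u t ω) (z t ω)) P) (hcond : ∀ t, P[u t | ℱ t] =ᵐ[P] 0) :
    Martingale (fun n ω => ∑ t ∈ Finset.range n, L (u t ω) (z t ω)) ℱ P := by
  refine martingale_of_condExp_sub_eq_zero_nat (fun n => ?_)
    (fun n => integrable_finsetSum _ fun t _ => huz t) fun n => ?_
  · refine Finset.stronglyMeasurable_fun_sum _ fun t ht => ?_
    have hut := (hu t).mono (ℱ.mono (Finset.mem_range.1 ht))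
    have hzt := (hz t).mono (ℱ.mono (Finset.mem_range.1 ht).le)
    exact L.continuous₂.comp_stronglyMeasurable (hut.prodMk hzt)
  · have hincrement : ((fun ω => ∑ t ∈ Finset.range (n + 1), L (u t ω) (z t ω))
        - fun ω => ∑ t ∈ Finset.range n, L (u t ω) (z t ω)) = fun ω => L (u n ω) (z n ω) := by
      ext ω
      simp [Finset.sum_range_succ]
    rw [hincrement]
    filter_upwards [condExp_bilin_of_stronglyMeasurable_right L (hz n) (huz n) (hui n), hcond n]
      with ω hω h0
    simp [hω, h0]

end MartingaleTransform

section TensorMartingale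

open TensorProduct

variable {Ω H : Type*} [m0 : MeasurableSpace Ω] {P : Measure Ω}
  [NormedAddCommGroup H] [InnerProductSpace ℝ H]

theorem norm_sum_tens_le {ι : Type*} (s : Finset ι) (a b : ι → H) :
    ‖∑ i ∈ s, tens (a i) (b i)‖ ≤ ‖∑ i ∈ s, a i ⊗ₜ[ℝ] b i‖ := by
  refine ContinuousLinearMap.opNorm_le_bound _ (norm_nonneg _) fun ζ => ?_
  set ξ := (∑ i ∈ s, tens (a i) (b i)) ζ
  have hinner : inner ℝ ξ ξ = inner ℝ (∑ i ∈ s, a i ⊗ₜ[ℝ] b i) (ζ ⊗ₜ[ℝ] ξ) := by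
    calc inner ℝ ξ ξ = ∑ i ∈ s, inner ℝ (tens (a i) (b i) ζ) ξ := by
          rw [← sum_inner, ← sum_apply]
      _ = _ := by
          simp only [sum_inner, TensorProduct.inner_tmul, tens_apply, real_inner_smul_left]
  have hle := real_inner_le_norm (∑ i ∈ s, a i ⊗ₜ[ℝ] b i) (ζ ⊗ₜ[ℝ] ξ)
  rw [← hinner, real_inner_self_eq_norm_sq, TensorProduct.norm_tmul, ← mul_assoc, sq] at hle
  rcases (norm_nonneg ξ).eq_or_lt with h0 | hpos
  · rw [← h0]
    positivity
  · exact le_of_mul_le_mul_right hle hpos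

/-- The vector `a ⊗ b` of the Hilbert space tensor product of `H` with itself. Its norm is the
Hilbert–Schmidt norm of `tens a b`; unlike the operator norm, it comes from an inner product. -/
noncomputable def hilbertTensor : H →L[ℝ] H →L[ℝ] UniformSpace.Completion (H ⊗[ℝ] H) :=
  (ContinuousLinearMap.compL ℝ H (H ⊗[ℝ] H) _ UniformSpace.Completion.toComplL).comp
    (TensorProduct.mkL ℝ H H)

theorem hilbertTensor_apply (a b : H) :
    hilbertTensor a b = ((a ⊗ₜ[ℝ] b : H ⊗[ℝ] H) : UniformSpace.Completion (H ⊗[ℝ] H)) := rfl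

theorem norm_hilbertTensor (a b : H) : ‖hilbertTensor a b‖ = ‖a‖ * ‖b‖ := by
  rw [hilbertTensor_apply, UniformSpace.Completion.norm_coe, TensorProduct.norm_tmul]

theorem norm_sum_tens_le_norm_sum_hilbertTensor {ι : Type*} (s : Finset ι) (a b : ι → H) :
    ‖∑ i ∈ s, tens (a i) (b i)‖ ≤ ‖∑ i ∈ s, hilbertTensor (a i) (b i)‖ := by
  have hsum : ∑ i ∈ s, hilbertTensor (a i) (b i) = UniformSpace.Completion.toComplL (𝕜 := ℝ)
      (∑ i ∈ s, a i ⊗ₜ[ℝ] b i) := by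
    simp only [map_sum, UniformSpace.Completion.coe_toComplL, hilbertTensor_apply]
  rw [hsum, UniformSpace.Completion.coe_toComplL, UniformSpace.Completion.norm_coe]
  exact norm_sum_tens_le s a b

variable [CompleteSpace H] [IsProbabilityMeasure P]

theorem ae_norm_sum_tens_sq_isBigO {ℱ : Filtration ℕ m0} {u z : ℕ → Ω → H} {m m' : ℝ}
    (hu : ∀ t, StronglyMeasurable[ℱ (t + 1)] (u t)) (hz : ∀ t, StronglyMeasurable[ℱ t] (z t))
    (hum : ∀ t, ∀ᵐ ω ∂P, ‖u t ω‖ ≤ m) (hzm : ∀ t, ∀ᵐ ω ∂P, ‖z t ω‖ ≤ m')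
    (hcond : ∀ t, P[u t | ℱ t] =ᵐ[P] 0) :
    ∀ᵐ ω ∂P, (fun n => ‖∑ t ∈ Finset.range n, tens (u t ω) (z t ω)‖ ^ 2)
      =O[atTop] fun n : ℕ => n * Real.log n := by
  have hbound (t : ℕ) : ∀ᵐ ω ∂P, ‖hilbertTensor (u t ω) (z t ω)‖ ≤ m * m' := by
    filter_upwards [hum t, hzm t] with ω h h'
    rw [norm_hilbertTensor]
    exact mul_le_mul h h' (norm_nonneg _) ((norm_nonneg _).trans h)
  have hu' (t : ℕ) := ((hu t).mono (ℱ.le _)).aestronglyMeasurable (μ := P)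
  have hz' (t : ℕ) := ((hz t).mono (ℱ.le _)).aestronglyMeasurable (μ := P)
  have hM := martingale_sum_bilin hilbertTensor hu hz (fun t => .of_bound (hu' t) m (hum t))
    (fun t => .of_bound (hilbertTensor.aestronglyMeasurable_comp₂ (hu' t) (hz' t)) _ (hbound t))
    hcond
  filter_upwards [ae_norm_sq_martingale_isBigO hM (.of_forall fun _ => by simp)
    (fun n => by simpa only [Finset.sum_range_succ, add_sub_cancel_left] using hbound n)] with ω hω
  refine .trans (.of_norm_le fun n => ?_) hω
  rw [norm_pow, norm_norm]
  exact pow_le_pow_left₀ (norm_nonneg _) (norm_sum_tens_le_norm_sum_hilbertTensor _ _ _) 2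

variable [TopologicalSpace.SeparableSpace H] [MeasurableSpace H] [BorelSpace H]

/-- The filtration formed by the information sets `past z e t`, with respect to which `z t` is
known at time `t` and `e t` at time `t + 1`. -/
def pastFiltration {z e : ℕ → Ω → H} (hz : ∀ t, Measurable (z t)) (he : ∀ t, Measurable (e t)) :
    Filtration ℕ m0 where
  seq := past z e
  mono' _ _ hst := sup_le_sup (biSup_mono fun _ h => le_trans h hst)
    (biSup_mono fun _ h => lt_of_lt_of_le h hst)
  le' _ := sup_le (iSup₂_le fun s _ => (hz s).comap_le) (iSup₂_le fun s _ => (he s).comap_le)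

theorem ae_norm_sampleCov_sq_isBigO {z e : ℕ → Ω → H} (hz : ∀ t, Measurable (z t))
    (he : ∀ t, Measurable (e t)) {m m' : ℝ} (hem : ∀ t, ∀ᵐ ω ∂P, ‖e t ω‖ ≤ m)
    (hzm : ∀ t, ∀ᵐ ω ∂P, ‖z t ω‖ ≤ m') (hcond : ∀ t, P[e t | past z e t] =ᵐ[P] 0) :
    ∀ᵐ ω ∂P, (fun T => ‖sampleCov e z T ω‖ ^ 2) =O[atTop] fun T : ℕ => Real.log T / T := by
  have : SecondCountableTopology H := UniformSpace.secondCountable_of_separable H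
  have he' (t : ℕ) : Measurable[past z e (t + 1)] (e t) :=
    .of_comap_le (le_sup_of_le_right (le_iSup₂_of_le t (Set.mem_Iio.2 t.lt_succ_self) le_rfl))
  have hz' (t : ℕ) : Measurable[past z e t] (z t) :=
    .of_comap_le (le_sup_of_le_left (le_iSup₂_of_le t Set.self_mem_Iic le_rfl))
  filter_upwards [ae_norm_sum_tens_sq_isBigO (ℱ := pastFiltration hz he)
    (fun t => (he' t).stronglyMeasurable) (fun t => (hz' t).stronglyMeasurable) hem hzm hcond]
    with ω hω
  refine ((isBigO_refl (fun T : ℕ => ((T : ℝ)⁻¹) ^ 2) atTop).mul hω).congr'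
    (.of_forall fun T => ?_) ?_
  · simp only [sampleCov, norm_smul, norm_inv, RCLike.norm_natCast, mul_pow]
  · filter_upwards [eventually_gt_atTop 0] with T hT
    have : (0 : ℝ) < T := Nat.cast_pos.2 hT
    field_simp

end TensorMartingale

section Rates

theorem tendsto_log_pow_div (k : ℕ) :
    Tendsto (fun T : ℕ => Real.log T ^ k / T) atTop (𝓝 0) :=
  (Real.isLittleO_pow_log_id_atTop (n := k)).tendsto_div_nhds_zero.comp tendsto_natCast_atTop_atTop

theorem log_div_isBigO_log_sq_div :
    (fun T : ℕ => Real.log T / T) =O[atTop] fun T : ℕ => Real.log T ^ 2 / T := by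
  refine .of_norm_eventuallyLE ?_
  filter_upwards [(Real.tendsto_log_atTop.comp tendsto_natCast_atTop_atTop).eventually_ge_atTop 1]
    with T hT
  rw [Real.norm_of_nonneg (div_nonneg (Real.log_natCast_nonneg T) T.cast_nonneg)]
  gcongr
  exact le_self_pow₀ hT two_ne_zero

theorem sq_isBigO_log_sq_div {r : ℕ → ℝ}
    (hr : r =O[atTop] fun T : ℕ => (T : ℝ) ^ (-1 / 2 : ℝ) * Real.log T) :
    (fun T => r T ^ 2) =O[atTop] fun T : ℕ => Real.log T ^ 2 / T := by
  refine (hr.pow 2).congr_right fun T => ?_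
  rw [mul_pow, ← Real.rpow_mul_natCast T.cast_nonneg, div_eq_inv_mul]
  norm_num [Real.rpow_neg_one]
  ring

theorem tendsto_log_sq_div_mul_inv_sqrt {α : ℕ → ℝ} (hα : ∀ T, 0 < α T)
    (hrate : Tendsto (fun T : ℕ => (α T)⁻¹ * (T : ℝ)⁻¹ * Real.log T) atTop (𝓝 0)) :
    Tendsto (fun T : ℕ => Real.log T ^ 2 / T * (√(α T))⁻¹) atTop (𝓝 0) := by
  have h := ((tendsto_log_pow_div 3).mul hrate).sqrt
  rw [mul_zero, Real.sqrt_zero] at h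
  refine h.congr fun T => ?_
  rw [← Real.sqrt_sq (by positivity : 0 ≤ Real.log T ^ 2 / T * (√(α T))⁻¹), mul_pow, inv_pow,
    Real.sq_sqrt (hα T).le]
  congr 1
  ring

theorem inv_sqrt_isBigO_inv_sqrt {ι : Type*} {l : Filter ι} {α α' : ι → ℝ} (hα : ∀ i, 0 < α i)
    (hα' : ∀ i, 0 < α' i) (h : α =O[l] α') :
    (fun i => (√(α' i))⁻¹) =O[l] fun i => (√(α i))⁻¹ := by
  refine .of_pow two_ne_zero ((h.inv_rev (.of_forall fun i hi => absurd hi (hα i).ne')).congr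
    (fun i => ?_) fun i => ?_)
  · rw [Pi.pow_apply, inv_pow, Real.sq_sqrt (hα' i).le]
  · rw [Pi.pow_apply, inv_pow, Real.sq_sqrt (hα i).le]

theorem tendsto_log_div_mul_inv_sqrt_mul_inv_sqrt {α α' : ℕ → ℝ} (hα : ∀ T, 0 < α T)
    (hα' : ∀ T, 0 < α' T) (h : α =O[atTop] α')
    (hrate : Tendsto (fun T : ℕ => (α T)⁻¹ * (T : ℝ)⁻¹ * Real.log T) atTop (𝓝 0)) :
    Tendsto (fun T : ℕ => Real.log T / T * ((√(α T))⁻¹ * (√(α' T))⁻¹)) atTop (𝓝 0) := by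
  refine ((isBigO_refl (fun T : ℕ => Real.log T / T) atTop).mul ((isBigO_refl _ _).mul
    (inv_sqrt_isBigO_inv_sqrt hα hα' h))).trans_tendsto (hrate.congr fun T => ?_)
  rw [← mul_inv (√(α T)), Real.mul_self_sqrt (hα T).le]
  ring

end Rates

section CovarianceOperators

variable {Ω H : Type*} [MeasurableSpace Ω] {P : Measure Ω}
  [NormedAddCommGroup H] [InnerProductSpace ℝ H] {L : H →L[ℝ] H}

open ContinuousLinearMap (adjoint)

theorem norm_tens (a b : H) : ‖tens a b‖ = ‖b‖ * ‖a‖ := InnerProductSpace.norm_rankOne b a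

theorem continuous_tens : Continuous fun q : H × H => tens q.1 q.2 :=
  (InnerProductSpace.rankOne ℝ (E := H) (F := H)).continuous₂.comp continuous_swap

theorem tens_add_left (a a' b : H) : tens (a + a') b = tens a b + tens a' b := by
  ext ζ
  simp [tens_apply, inner_add_left, add_smul]

theorem norm_tens_le {a b : H} {m m' : ℝ} (ha : ‖a‖ ≤ m) (hb : ‖b‖ ≤ m') :
    ‖tens a b‖ ≤ m' * m := by
  rw [norm_tens]
  exact mul_le_mul hb ha (norm_nonneg _) ((norm_nonneg _).trans hb)

theorem ae_norm_sub_map_le {a b e : Ω → H} {m m' : ℝ} (h : ∀ᵐ ω ∂P, b ω = L (a ω) + e ω)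
    (hb : ∀ᵐ ω ∂P, ‖b ω‖ ≤ m) (ha : ∀ᵐ ω ∂P, ‖a ω‖ ≤ m') : ∀ᵐ ω ∂P, ‖e ω‖ ≤ m + ‖L‖ * m' := by
  filter_upwards [h, hb, ha] with ω h hb ha
  rw [eq_sub_of_add_eq' h.symm]
  exact norm_sub_le_of_le hb (L.le_opNorm_of_le ha)

theorem integrable_tens [IsFiniteMeasure P] [TopologicalSpace.SeparableSpace H]
    [MeasurableSpace H] [BorelSpace H] {a b : Ω → H} {m m' : ℝ} (ha : Measurable a)
    (hb : Measurable b) (ham : ∀ᵐ ω ∂P, ‖a ω‖ ≤ m) (hbm : ∀ᵐ ω ∂P, ‖b ω‖ ≤ m') :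
    Integrable (fun ω => tens (a ω) (b ω)) P := by
  have : SecondCountableTopology H := UniformSpace.secondCountable_of_separable H
  refine .of_bound (continuous_tens.comp_aestronglyMeasurable (f := fun ω => (a ω, b ω))
    (ha.prodMk hb).stronglyMeasurable.aestronglyMeasurable) (m' * m) ?_
  filter_upwards [ham, hbm] with ω h h' using norm_tens_le h h'

variable [CompleteSpace H]

theorem tens_apply_left (a b : H) : tens (L a) b = tens a b ∘L adjoint L := by
  ext ζ
  simp [tens_apply, ContinuousLinearMap.adjoint_inner_right]

theorem sampleCov_linear {Ω : Type*} {a b e z : ℕ → Ω → H} {ω : Ω}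
    (h : ∀ t, b t ω = L (a t ω) + e t ω) (T : ℕ) :
    sampleCov b z T ω = sampleCov a z T ω ∘L adjoint L + sampleCov e z T ω := by
  simp only [sampleCov, h, tens_add_left, tens_apply_left, Finset.sum_add_distrib, smul_add,
    ContinuousLinearMap.smul_comp, ContinuousLinearMap.finsetSum_comp]

theorem adjoint_crossCov (a b : Ω → H) : adjoint (crossCov P a b) = crossCov P b a := by
  have h := ((adjoint (𝕜 := ℝ) (E := H) (F := H)).toContinuousLinearEquiv).integral_comp_comm
    (μ := P) (fun ω => tens (a ω) (b ω))
  simpa [adjoint_tens, crossCov] using h.symm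

theorem crossCov_linear {a b e z : Ω → H} (h : ∀ᵐ ω ∂P, b ω = L (a ω) + e ω)
    (ha : Integrable (fun ω => tens (a ω) (z ω)) P)
    (he : Integrable (fun ω => tens (e ω) (z ω)) P) :
    crossCov P b z = crossCov P a z ∘L adjoint L + crossCov P e z := by
  let R := (ContinuousLinearMap.compL ℝ H H H).flip (adjoint L)
  have hsplit : ∀ᵐ ω ∂P, tens (b ω) (z ω) = R (tens (a ω) (z ω)) + tens (e ω) (z ω) := by
    filter_upwards [h] with ω hω
    rw [hω, tens_add_left, tens_apply_left]
    rfl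
  rw [crossCov, integral_congr_ae hsplit, integral_add (R.integrable_comp ha) he,
    R.integral_comp_comm ha]
  rfl

theorem crossCov_eq_of_uncorrelated {a b e : Ω → H} (h : ∀ᵐ ω ∂P, b ω = L (a ω) + e ω)
    (ha : Integrable (fun ω => tens (a ω) (a ω)) P)
    (he : Integrable (fun ω => tens (e ω) (a ω)) P) (hae : crossCov P a e = 0) :
    crossCov P b a = crossCov P a a ∘L adjoint L := by
  rw [crossCov_linear h ha he, ← adjoint_crossCov a e, hae, map_zero, add_zero]

variable [TopologicalSpace.SeparableSpace H] [MeasurableSpace H] [BorelSpace H]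
  [IsProbabilityMeasure P] {v z : ℕ → Ω → H} {m m' : ℝ}

theorem ae_tendsto_sampleCov (hz : ∀ t, Measurable (z t)) (hst : IsStationary P z)
    (hmix : IsGeomStronglyMixing P z) (hzm : ∀ᵐ ω ∂P, ‖z 0 ω‖ ≤ m) :
    ∀ᵐ ω ∂P, Tendsto (fun T => sampleCov z z T ω) atTop (𝓝 (crossCov P (z 0) (z 0))) := by
  have : SecondCountableTopology H := UniformSpace.secondCountable_of_separable H
  have htens : StronglyMeasurable fun a : H => tens a a :=
    (continuous_tens.comp (continuous_id.prodMk continuous_id)).stronglyMeasurable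
  have hlim := hmix.obeysSLLN hst hz htens (hzm.mono fun ω h => norm_tens_le h h)
  rwa [ObeysSLLN, integral_map (hz 0).aemeasurable htens.aestronglyMeasurable] at hlim

theorem ae_norm_sampleCov_sq_isBigO_of_martingale_or_rate (hz : ∀ t, Measurable (z t))
    (hv : ∀ t, Measurable (v t)) (hvm : ∀ t, ∀ᵐ ω ∂P, ‖v t ω‖ ≤ m)
    (hzm : ∀ t, ∀ᵐ ω ∂P, ‖z t ω‖ ≤ m')
    (h : (∀ t, P[v t | past z v t] =ᵐ[P] 0) ∨
      ∀ᵐ ω ∂P, (fun T => ‖sampleCov v z T ω‖) =O[atTop]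
        fun T : ℕ => (T : ℝ) ^ (-1 / 2 : ℝ) * Real.log T) :
    ∀ᵐ ω ∂P, (fun T => ‖sampleCov v z T ω‖ ^ 2) =O[atTop] fun T : ℕ => Real.log T ^ 2 / T := by
  rcases h with hcond | hrate
  · filter_upwards [ae_norm_sampleCov_sq_isBigO hz hv hvm hzm hcond] with ω hω
    exact hω.trans log_div_isBigO_log_sq_div
  · filter_upwards [hrate] with ω hω using sq_isBigO_log_sq_div hω

end CovarianceOperators

end FIV

theorem theorem5_general {Ω H : Type*} [MeasurableSpace Ω]
    [NormedAddCommGroup H] [InnerProductSpace ℝ H] [CompleteSpace H]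
    [TopologicalSpace.SeparableSpace H] [MeasurableSpace H] [BorelSpace H]
    {P : Measure Ω} [IsProbabilityMeasure P] {A B : H →L[ℝ] H} {x y z u v : ℕ → Ω → H}
    {μ : ℕ → ℝ} {g : ℕ → H} {mx mz mu : ℝ} {α₁ α₂ : ℕ → ℝ}
    (hz : ∀ t, Measurable (z t)) (hu : ∀ t, Measurable (u t)) (hv : ∀ t, Measurable (v t))
    (hmodel : ∀ t, ∀ᵐ ω ∂P, y t ω = A (x t ω) + u t ω)
    (hfirst : ∀ t, ∀ᵐ ω ∂P, x t ω = B (z t ω) + v t ω) (hzv : FIV.crossCov P (z 0) (v 0) = 0)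
    (hst : FIV.IsStationary P z) (hmix : FIV.IsGeomStronglyMixing P z)
    (hxm : ∀ t, ∀ᵐ ω ∂P, ‖x t ω‖ ≤ mx) (hzm : ∀ t, ∀ᵐ ω ∂P, ‖z t ω‖ ≤ mz)
    (hum : ∀ t, ∀ᵐ ω ∂P, ‖u t ω‖ ≤ mu) (hu_mart : ∀ t, P[u t | FIV.past z u t] =ᵐ[P] 0)
    (hv_rate : (∀ t, P[v t | FIV.past z v t] =ᵐ[P] 0) ∨
      ∀ᵐ ω ∂P, (fun T => ‖FIV.sampleCov v z T ω‖) =O[atTop]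
        fun T : ℕ => (T : ℝ) ^ (-1 / 2 : ℝ) * Real.log T)
    (hμ : FIV.IsEigenSystem (FIV.crossCov P (z 0) (z 0)) μ g) (hμ_pos : ∀ j, 0 < μ j)
    (hker : ∀ ζ, FIV.popQ (FIV.crossCov P (x 0) (z 0)) μ g ζ = 0 → ζ = 0) (hA : FIV.IsHS A)
    (hα₁ : ∀ T, 0 < α₁ T) (hα₂ : ∀ T, 0 < α₂ T) (hα₂_lim : Tendsto α₂ atTop (𝓝 0))
    (hα_ratio : α₁ =O[atTop] α₂)
    (hα₁_rate : Tendsto (fun T : ℕ => (α₁ T)⁻¹ * (T : ℝ)⁻¹ * Real.log T) atTop (𝓝 0))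
    {μ' ν' : ℕ → Ω → ℕ → ℝ} {g' h' : ℕ → Ω → ℕ → H} {K₁ K₂ : ℕ → Ω → ℕ}
    (hμ' : ∀ T ω, FIV.IsEigenSystem (FIV.sampleCov z z T ω) (μ' T ω) (g' T ω))
    (hK₁ : ∀ T ω, K₁ T ω = FIV.numAbove (μ' T ω) (α₁ T))
    (hν' : ∀ T ω, FIV.IsEigenSystem (FIV.sampleQ x z (μ' T ω) (g' T ω) (K₁ T ω) T ω)
      (ν' T ω) (h' T ω))
    (hK₂ : ∀ T ω, K₂ T ω = FIV.numAbove (ν' T ω) (α₂ T)) :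
    ∀ᵐ ω ∂P, Tendsto (fun T => ‖FIV.f2slse x y z (μ' T ω) (g' T ω) (ν' T ω) (h' T ω)
      (K₁ T ω) (K₂ T ω) T ω - A‖) atTop (𝓝 0) := by
  have hvm (t : ℕ) := FIV.ae_norm_sub_map_le (hfirst t) (hxm t) (hzm t)
  have hxz := FIV.crossCov_eq_of_uncorrelated (hfirst 0)
    (FIV.integrable_tens (hz 0) (hz 0) (hzm 0) (hzm 0))
    (FIV.integrable_tens (hv 0) (hz 0) (hvm 0) (hzm 0)) hzv
  have hα₁_lim := hα_ratio.trans_tendsto hα₂_lim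
  filter_upwards [ae_all_iff.2 hmodel, ae_all_iff.2 hfirst,
    FIV.ae_tendsto_sampleCov hz hst hmix (hzm 0),
    FIV.ae_norm_sampleCov_sq_isBigO hz hu hum hzm hu_mart,
    FIV.ae_norm_sampleCov_sq_isBigO_of_martingale_or_rate hz hv hvm hzm hv_rate]
    with ω hy hx hC hU hV
  obtain rfl : K₁ = fun T ω => FIV.numAbove (μ' T ω) (α₁ T) := funext₂ hK₁
  obtain rfl : K₂ = fun T ω => FIV.numAbove (ν' T ω) (α₂ T) := funext₂ hK₂
  have hV_lim := (hV.trans_tendsto (FIV.tendsto_log_pow_div 2)).sqrt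
  simp only [Real.sqrt_sq (norm_nonneg _), Real.sqrt_zero] at hV_lim
  have hlim := FIV.tendsto_twoStage hA (hμ.denseRange_of_popQ_injective hμ_pos hxz hker) hC
    (FIV.sampleCov_linear hx) hα₁ hα₁_lim hα₂ hα₂_lim (tendsto_zero_iff_norm_tendsto_zero.2 hV_lim)
    ((hV.mul (isBigO_refl _ _)).trans_tendsto (FIV.tendsto_log_sq_div_mul_inv_sqrt hα₁ hα₁_rate))
    ((hU.mul (isBigO_refl _ _)).trans_tendsto
      (FIV.tendsto_log_div_mul_inv_sqrt_mul_inv_sqrt hα₁ hα₂ hα_ratio hα₁_rate))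
    (fun T => hμ' T ω) fun T => hν' T ω
  simp only [← FIV.sampleCov_linear hy] at hlim
  exact tendsto_iff_norm_sub_tendsto_zero.1 hlim

theorem theorem5 {Ω H : Type*} [MeasurableSpace Ω]
    [NormedAddCommGroup H] [InnerProductSpace ℝ H] [CompleteSpace H]
    [TopologicalSpace.SeparableSpace H] [MeasurableSpace H] [BorelSpace H]
    (P : Measure Ω) [IsProbabilityMeasure P]
    (A B : H →L[ℝ] H) (x y z u v : ℕ → Ω → H)
    (μ : ℕ → ℝ) (g : ℕ → H) (ν : ℕ → ℝ) (h : ℕ → H)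
    (hmodel : FIV.ModelAssumptions P A B x y z u v μ g ν h)
    (hstrong : FIV.StrongAssumptions P x z u v)
    -- the regularization parameters, as functions of the sample size `T`
    (α₁ α₂ : ℕ → ℝ) (hα₁ : ∀ T, 0 < α₁ T) (hα₂ : ∀ T, 0 < α₂ T)
    (hα₁_lim : Tendsto α₁ atTop (𝓝 0)) (hα₂_lim : Tendsto α₂ atTop (𝓝 0))
    (hα_ratio : Tendsto (fun T => α₁ T * (α₂ T)⁻¹) atTop (𝓝 0))
    (hα₁_rate : Tendsto (fun T : ℕ => (α₁ T)⁻¹ * (T : ℝ)⁻¹ * Real.log T) atTop (𝓝 0))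
    -- eigenelements of the sample operators, and the numbers `K₁`, `K₂` of those that are retained
    (μ' : ℕ → Ω → ℕ → ℝ) (g' : ℕ → Ω → ℕ → H) (ν' : ℕ → Ω → ℕ → ℝ) (h' : ℕ → Ω → ℕ → H)
    (K₁ K₂ : ℕ → Ω → ℕ)
    (hμ' : ∀ T ω, FIV.IsEigenSystem (FIV.sampleCov z z T ω) (μ' T ω) (g' T ω))
    (hK₁ : ∀ T ω, K₁ T ω = FIV.numAbove (μ' T ω) (α₁ T))
    (hν' : ∀ T ω, FIV.IsEigenSystem (FIV.sampleQ x z (μ' T ω) (g' T ω) (K₁ T ω) T ω)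
      (ν' T ω) (h' T ω))
    (hK₂ : ∀ T ω, K₂ T ω = FIV.numAbove (ν' T ω) (α₂ T))
    -- the conditions on the spectral gaps
    (hgap : ∀ᵐ ω ∂P, (fun T : ℕ => (∑ j ∈ Finset.range (K₁ T ω), μ j * FIV.tau μ j) *
        ∑ j ∈ Finset.range (K₂ T ω), FIV.tau ν j)
      =o[atTop] fun T : ℕ => (T : ℝ) ^ (1 / 2 : ℝ) * Real.log T ^ (-3 / 2 : ℝ))
    (htail : ∀ᵐ ω ∂P, Tendsto (fun T => (∑' j, μ (K₁ T ω + j)) *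
        ∑ j ∈ Finset.range (K₂ T ω), FIV.tau ν j) atTop (𝓝 0)) :
    ∀ᵐ ω ∂P, Tendsto (fun T => ‖FIV.f2slse x y z (μ' T ω) (g' T ω) (ν' T ω) (h' T ω)
      (K₁ T ω) (K₂ T ω) T ω - A‖) atTop (𝓝 0) := by
  obtain ⟨mx, hx⟩ := hstrong.bounded_x
  obtain ⟨mz, hz⟩ := hstrong.bounded_z
  obtain ⟨mu, hu⟩ := hstrong.bounded_u
  have hα : α₁ =O[atTop] α₂ :=
    (isLittleO_of_tendsto (fun T hT => absurd hT (hα₂ T).ne')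
      (hα_ratio.congr fun T => (div_eq_mul_inv _ _).symm)).isBigO
  exact theorem5_general hmodel.measurable_z hmodel.measurable_u hmodel.measurable_v hmodel.model
    hmodel.first_stage (hmodel.crossCov_zv 0)
    (hmodel.stationary.comp (fun t => (hmodel.measurable_x t).prodMk (hmodel.measurable_z t))
      measurable_snd)
    (hmodel.mixing.comp (f := Prod.snd) measurable_snd) (ae_all_iff.1 hx) (ae_all_iff.1 hz)
    (ae_all_iff.1 hu) hmodel.martingale_u hstrong.martingale_or_rate hmodel.eigen_Czz hmodel.pos_μ
    hmodel.ker_Q hmodel.isHS_A hα₁ hα₂ hα₂_lim hα hα₁_rate hμ' hK₁ hν' hK₂
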